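/- **Setting.** Let $p>3$ be a prime, $e\in\{0,1\}$, and let $x,y,z$ be non-zero integers with $\gcd(x,y,z)=1$, $x+y\ne 0$ and $$\frac{x^p+y^p}{x+y}=p^e z^p ,$$ where $|x|<|y|$ and $p\nmid y$. Let $\mathbb K=\mathbb Q(\zeta)$ with $\zeta$ a primitive $p$-th root of unity, let $G=\mathrm{Gal}(\mathbb K/\mathbb Q)=\{\sigma_c : 1\le c\le p-1\}$, $\sigma_c(\zeta)=\zeta^c$, and write $\bar{\ }$ for complex conjugation. Let $I=\vartheta\mathbb Z[G]\cap\mathbb Z[G]$ be the Stickelberger ideal, $\vartheta=\frac1p\sum_{c=1}^{p-1}c\,\sigma_c^{-1}$. Let $\theta=\sum_c n_c\sigma_c^{-1}\in I$ with all $n_c\ge 0$ and $\sum_c c^{p-2}n_c\equiv 0 \pmod p$, and let $\varsigma=\varsigma(\theta)=n_c+n_{p-c}$ be its relative weight. Put $\alpha=(x+\zeta y)/(1-\zeta)^e$ and $\mathfrak A=(\alpha,z)\subset\mathbb Z[\zeta]$. Let $\beta=\beta(\theta)\in\mathbb Z[\zeta]$ be the Jacobi number of $\mathfrak A^\theta$,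 i.e. the generator of $\mathfrak A^{\theta}$ with $\beta\bar\beta=z^{\varsigma}$ and $\beta\equiv 1 \bmod (1-\zeta)^2$, and put $\gamma=\beta/\bar\beta$, so that $\beta^2=z^\varsigma\gamma$. Let $$F_\theta(T)=\prod_c\left(\frac{1+\sigma_c^{-1}(\zeta)T}{1+\sigma_c^{-1}(\bar\zeta)T}\right)^{n_c/p}=\sum_{n\ge0}a_nT^n\in\mathbb K[[T]]$$ (binomial series), $E(n)=n+v_p(n!)$ and $c_n=p^{E(n)}$. In the semilocal ring $\mathbb K_y=\prod_{r\mid y}(\mathbb K\otimes_{\mathbb Q}\mathbb Q_r)$ (product over the primes $r\mid y$), in which $\mathbb K$ is embedded diagonally, put $\rho=\gamma/F_\theta(y/x)$, and let $$\rho\, c_na_n=\sum_{h\ge0}b_{n,h}y^h\qquad(n\ge 0)$$ be the $y$-adic developments whose digits $b_{n,h}\in\mathbb Z[\zeta]$ have coordinates in $(-|y|/2,|y|/2]$ with respect to the basis $\zeta,\zeta^2,\dots,\zeta^{p-1}$. Then, with convergence in $\mathbb K_y$, $$\beta^2=z^{\varsigma}\sum_{n,h\ge0}\frac{b_{n,h}\,y^{n+h}}{c_n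 x^n}=z^{\varsigma}\sum_{m\ge0}y^m\sum_{h=0}^m\frac{b_{m-h,h}}{c_{m-h}x^{m-h}}.\tag{1}$$ Order the pairs of non-negative integers by $(j_1,k_1)\preceq(j_2,k_2)$ iff $j_1+k_1<j_2+k_2$, or $j_1+k_1=j_2+k_2$ and $k_1\le k_2$. Let $\Omega(j,k)$ be the number of pairs $\preceq(j,k)$, and let $(\mu,\chi)$ be the pair with $\Omega(\mu,\chi)=p-1$. Let $\nu(u)=(\sigma_c(u))_{c}\in\mathbb K^{p-1}$ for $u\in\mathbb K$ and $\mathbb K_G=\nu(\mathbb K)$. **Proposition.** There is an algorithm (one algorithm for all the data above) which, upon input of $p,x,y$ and the coefficients $b_{n,h}$, computes coefficients $\widetilde b_{n,h}\in\mathbb Z[\zeta]$ and integers $d(n,h)\in\{1,p\}$ for all $n,h\ge0$, each of them from finitely many of the $b_{n,h}$, such that $\widetilde b_{n,h}=b_{n,h}$ for all but finitely many pairs and the following hold. 1. The sum (1) is preserved: with convergence in $\mathbb K_y$, $$\beta^2=z^{\varsigma}\sum_{n,h\ge0}\frac{\widetilde b_{n,h}\,y^{n+h}}{d(n,h)\,c_n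 x^n}=z^{\varsigma}\sum_{m\ge0}y^m\sum_{h=0}^m\frac{\widetilde b_{m-h,h}}{d(m-h,h)\,c_{m-h}x^{m-h}}.$$ Moreover there are $e_n\in\{0,1\}$ such that $d(n,h)\,c_n=p^{n+e_n}$ for all $n<p$ and all $h$. 2. For every $(k,h)\preceq(\mu,\chi)$ the vectors $\nu(\widetilde b_{i,j})$, $(i,j)\preceq(k,h)$, are linearly independent over $\mathbb K$, and the $\mathbb Q$-space $U_{k,h}$, the intersection of their $\mathbb K$-span with $\mathbb K_G$, has dimension $\Omega(k,h)$. For $(k,h),(k',h')\preceq(\mu,\chi)$, one has $U_{k,h}\subsetneq U_{k',h'}$ if and only if $(k,h)\prec(k',h')$. 3. For all $n,h\ge 0$, the coordinates of $\widetilde b_{n,h}$ with respect to $\zeta,\dots,\zeta^{p-1}$ have absolute value $<|y|$. -/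

import Mathlib

open scoped TensorProduct Pointwise NumberField

noncomputable section

namespace SuperFermat

/-! ### The equation -/

/-- `(x, y, z)` is a solution of `(x ^ p + y ^ p) / (x + y) = p ^ e * z ^ p` in non-zero coprime
integers, with `p > 3` prime and `e ∈ {0, 1}`. -/
structure IsSolution (p : ℕ) (x y z : ℤ) (e : ℕ) : Prop where
  prime : p.Prime
  three_lt : 3 < p
  e_mem : e = 0 ∨ e = 1
  x_ne : x ≠ 0
  y_ne : y ≠ 0
  z_ne : z ≠ 0
  coprime : Int.gcd x (Int.gcd y z) = 1
  add_ne : x + y ≠ 0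
  eqn : x ^ p + y ^ p = (x + y) * ((p : ℤ) ^ e * z ^ p)

/-! ### The cyclotomic field, its Galois group and the Stickelberger ideal

The Galois group is indexed by `(ZMod p)ˣ`, the unit `c` standing for `σ_c : ζ ↦ ζ ^ c`. -/

section Cyclotomic

variable (p : ℕ) [Fact p.Prime] (K : Type*) [Field K] [NumberField K]
  [IsCyclotomicExtension {p} ℚ K]

/-- The automorphism `σ_c` of the `p`-th cyclotomic field, `ζ ↦ ζ ^ c`. -/
def sigma (c : (ZMod p)ˣ) : K ≃ₐ[ℚ] K :=
  (IsCyclotomicExtension.autEquivPow K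
    (Polynomial.cyclotomic.irreducible_rat (Nat.Prime.pos (Fact.out : p.Prime)))).symm c

/-- The Galois orbit map `ν : x ↦ (σ_c x)_c`; its range is the space `K_G`. -/
def nu : K →ₗ[ℚ] ((ZMod p)ˣ → K) :=
  LinearMap.pi fun c => (sigma p K c).toLinearMap

/-- The group ring `ℤ[G]`; the coefficient of `θ` at `c` is the coefficient of `σ_c`. -/
abbrev GroupRing : Type := MonoidAlgebra ℤ (ZMod p)ˣ

/-- The Stickelberger element `ϑ = (1 / p) ∑ c σ_c⁻¹` in `ℚ[G]`. -/
def stickelberger : MonoidAlgebra ℚ (ZMod p)ˣ :=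
  ∑ c : (ZMod p)ˣ, MonoidAlgebra.single c⁻¹ (((c : ZMod p).val : ℚ) / p)

/-- Membership in the Stickelberger ideal `I = ϑ ℤ[G] ∩ ℤ[G]`. -/
def MemStickelberger (θ : GroupRing p) : Prop :=
  ∃ t : GroupRing p,
    MonoidAlgebra.mapRingHom (ZMod p)ˣ (Int.castRingHom ℚ) θ =
      stickelberger p * MonoidAlgebra.mapRingHom (ZMod p)ˣ (Int.castRingHom ℚ) t

/-- The Fermat quotient map `φ (∑ n_c σ_c⁻¹) = ∑ c ^ (p - 2) n_c` with values in `𝔽_p`. -/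
def fermatQuotient (θ : GroupRing p) : ZMod p :=
  ∑ c : (ZMod p)ˣ, (c : ZMod p) ^ (p - 2) * ((θ.coeff c⁻¹ : ℤ) : ZMod p)

/-- `θ` is a positive element, of relative weight `w`, of `I₀ = ker φ ∩ I`. -/
structure IsAdmissible (θ : GroupRing p) (w : ℕ) : Prop where
  mem : MemStickelberger p θ
  fermat : fermatQuotient p θ = 0
  nonneg : ∀ c, 0 ≤ θ.coeff c
  weight : ∀ c, θ.coeff c + θ.coeff (-c) = w

variable {K}

/-- The characteristic number `α = (x + ζ y) / (1 - ζ) ^ e`. -/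
def charNumber (ζ : K) (x y : ℤ) (e : ℕ) : K := ((x : K) + ζ * y) / (1 - ζ) ^ e

/-- The characteristic ideal `(α, z)` of the ring of integers. -/
def charIdeal (ζ : K) (x y z : ℤ) (e : ℕ) : Ideal (𝓞 K) :=
  Ideal.span {a : 𝓞 K | (a : K) = charNumber ζ x y e ∨ (a : K) = z}

/-- The action `J ↦ J ^ θ` of a positive `θ` on ideals. -/
def idealPow (J : Ideal (𝓞 K)) (θ : GroupRing p) : Ideal (𝓞 K) :=
  ∏ c : (ZMod p)ˣ, (sigma p K c • J) ^ (θ.coeff c).toNat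

/-- `β` is the Jacobi number `β(θ)`: the generator of `𝔄 ^ θ`, where `𝔄` is the characteristic
ideal, that is normed by `β * conj β = z ^ w` and `β ≡ 1` modulo `(1 - ζ) ^ 2`. Two such generators
differ by a root of unity congruent to `1` modulo `(1 - ζ) ^ 2`, so they agree. -/
structure IsBeta (ζ : K) (x y z : ℤ) (e : ℕ) (θ : GroupRing p) (w : ℕ) (β : 𝓞 K) : Prop where
  span_eq : Ideal.span {β} = idealPow p (charIdeal ζ x y z e) θ
  norm_eq : (β : K) * sigma p K (-1) β = (z : K) ^ w
  normed : ∃ t : 𝓞 K, (β : K) = 1 + (1 - ζ) ^ 2 * (t : K)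

/-- `γ(θ) = β(θ) / conj β(θ)`. -/
def gamma (β : 𝓞 K) : K := (β : K) / sigma p K (-1) β

/-! ### The binomial series -/

/-- The binomial series `(1 + u T) ^ r`. -/
def binomSeries (r : ℚ) (u : K) : PowerSeries K :=
  PowerSeries.mk fun n => algebraMap ℚ K (Ring.choose r n) * u ^ n

/-- `F_θ(T) = (1 + ζ T) ^ ((1 - j) θ / p)`, the product over `c` of the series
`(1 + σ_c(ζ) T) ^ (θ_c / p) * (1 + σ_c(ζ⁻¹) T) ^ (- θ_c / p)`. -/
def series (ζ : K) (θ : GroupRing p) : PowerSeries K :=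
  ∏ c : (ZMod p)ˣ,
    binomSeries ((θ.coeff c : ℚ) / p) (sigma p K c ζ) *
      binomSeries (-((θ.coeff c : ℚ) / p)) (sigma p K c ζ⁻¹)

/-- The coefficient `a_n(θ)` of `F_θ`. -/
def aCoeff (ζ : K) (θ : GroupRing p) (n : ℕ) : K := PowerSeries.coeff n (series p ζ θ)

end Cyclotomic

/-- The exponent `E(n) = n + v_p(n!)`. -/
def expE (p n : ℕ) : ℕ := n + padicValNat p n.factorial

/-- The denominators `c_n = p ^ E(n)`. -/
def cDen (p n : ℕ) : ℕ := p ^ expE p n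

/-- The element of `ℤ[ζ]` with coordinates `v` in the basis `ζ, ζ ^ 2, …, ζ ^ (p - 1)`. -/
def ofCoords {p : ℕ} {K : Type*} [Field K] (ζ : K) (v : Fin (p - 1) → ℤ) : K :=
  ∑ i : Fin (p - 1), (v i : K) * ζ ^ ((i : ℕ) + 1)

/-! ### The semilocal ring `K_y` -/

/-- The ring of `r`-adeles `K_r = ℚ_r ⊗ K`, the product of the completions of `K` above `r`. -/
def LocalRing (K : Type*) [Field K] [NumberField K] (r : ℕ) [Fact r.Prime] : Type _ :=
  ℚ_[r] ⊗[ℚ] K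

section LocalRing

variable (K : Type*) [Field K] [NumberField K] (r : ℕ) [Fact r.Prime]

instance : CommRing (LocalRing K r) := inferInstanceAs (CommRing (ℚ_[r] ⊗[ℚ] K))

instance : Algebra ℚ_[r] (LocalRing K r) := inferInstanceAs (Algebra ℚ_[r] (ℚ_[r] ⊗[ℚ] K))

/-- The topology of a finite-dimensional `ℚ_r`-vector space, i.e. the product topology in
coordinates, which is also the product of the topologies of the completions. -/
instance : TopologicalSpace (LocalRing K r) := moduleTopology ℚ_[r] (LocalRing K r)

/-- The diagonal embedding of `K` in `K_r`. -/
def toLocalRing : K →+* LocalRing K r :=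
  (Algebra.TensorProduct.includeRight : K →ₐ[ℚ] ℚ_[r] ⊗[ℚ] K).toRingHom

end LocalRing

instance primeFactor_fact (y : ℤ) (r : y.natAbs.primeFactors) : Fact (r : ℕ).Prime :=
  ⟨Nat.prime_of_mem_primeFactors r.2⟩

/-- The semilocal ring `K_y`, the product of the `K_r` over the primes `r` dividing `y`, with the
product topology. -/
abbrev SemiLocal (K : Type*) [Field K] [NumberField K] (y : ℤ) : Type _ :=
  ∀ r : y.natAbs.primeFactors, LocalRing K (r : ℕ)

/-- The diagonal embedding of `K` in `K_y`. -/
def iota (K : Type*) [Field K] [NumberField K] (y : ℤ) : K →+* SemiLocal K y :=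
  RingHom.pi fun r => toLocalRing K (r : ℕ)

section Development

variable (p : ℕ) [Fact p.Prime] {K : Type*} [Field K] [NumberField K]
  [IsCyclotomicExtension {p} ℚ K]

/-- `Φ_θ = F_θ(y / x)`, the sum in `K_y`. -/
def seriesValue (ζ : K) (x y : ℤ) (θ : GroupRing p) : SemiLocal K y :=
  ∑' n : ℕ, iota K y (aCoeff p ζ θ n * ((y : K) / x) ^ n)

/-- The vectors `b n h` are the coordinates of the coefficients `b_{n,h}(θ)`: with
`ρ = γ(θ) / Φ_θ` and `a'_n = c_n a_n`, the element `ρ a'_n` of `K_y` has the `y`-adic development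
`∑ b_{n,h} y ^ h`, with digits whose coordinates lie in `(- |y| / 2, |y| / 2]`. -/
structure IsDevelopment (ζ : K) (x y : ℤ) (θ : GroupRing p) (β : 𝓞 K)
    (b : ℕ → ℕ → Fin (p - 1) → ℤ) : Prop where
  digit : ∀ n h i, -|y| < 2 * b n h i ∧ 2 * b n h i ≤ |y|
  hasSum : ∃ ρ : SemiLocal K y,
    ρ * seriesValue p ζ x y θ = iota K y (gamma p β) ∧
    ∀ n, HasSum (fun h : ℕ => iota K y (ofCoords ζ (b n h) * (y : K) ^ h))
      (ρ * iota K y ((cDen p n : K) * aCoeff p ζ θ n))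

/-- The term `z ^ w * b_{n,h} y ^ (n + h) / (d_{n,h} c_n x ^ n)` of the double series. -/
def term (ζ : K) (x y z : ℤ) (w : ℕ) (b : ℕ → ℕ → Fin (p - 1) → ℤ) (d : ℕ → ℕ → ℕ)
    (n h : ℕ) : K :=
  (z : K) ^ w * (ofCoords ζ (b n h) * (y : K) ^ (n + h) /
    ((d n h : K) * (cDen p n : K) * (x : K) ^ n))

/-- The double series with coefficients `b` and denominators `d_{n,h} c_n x ^ n`, multiplied by
`z ^ w`, converges in `K_y` to the image of `s ∈ K`, both as a series over the pairs `(n, h)` and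
when it is summed along `n + h = m`. -/
def SumsTo (ζ : K) (x y z : ℤ) (w : ℕ) (b : ℕ → ℕ → Fin (p - 1) → ℤ) (d : ℕ → ℕ → ℕ)
    (s : K) : Prop :=
  HasSum (fun q : ℕ × ℕ => iota K y (term p ζ x y z w b d q.1 q.2)) (iota K y s) ∧
  HasSum (fun m : ℕ => iota K y (∑ h ∈ Finset.range (m + 1), term p ζ x y z w b d (m - h) h))
    (iota K y s)

end Development

/-! ### The order of the pairs of indices, and the spaces `U_{k,h}` -/

/-- The order `⪯` on pairs of indices. -/
def PairLE (q q' : ℕ × ℕ) : Prop :=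
  q.1 + q.2 < q'.1 + q'.2 ∨ (q.1 + q.2 = q'.1 + q'.2 ∧ q.2 ≤ q'.2)

/-- The strict order `≺` on pairs of indices. -/
def PairLT (q q' : ℕ × ℕ) : Prop := PairLE q q' ∧ q ≠ q'

/-- The counting function `Ω(q) = #{q' : q' ⪯ q}`. -/
def Omega (q : ℕ × ℕ) : ℕ := {q' : ℕ × ℕ | PairLE q' q}.ncard

section Spaces

variable (p : ℕ) [Fact p.Prime] {K : Type*} [Field K] [NumberField K]
  [IsCyclotomicExtension {p} ℚ K]

/-- The coefficient vector `ν(b_{k,h})`. -/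
def coeffVec (ζ : K) (b : ℕ → ℕ → Fin (p - 1) → ℤ) (q : ℕ × ℕ) : (ZMod p)ˣ → K :=
  nu p K (ofCoords ζ (b q.1 q.2))

/-- The space `U_q`: the `K`-span of the vectors `ν(b_{q'})`, `q' ⪯ q`, intersected with `K_G`. -/
def spaceU (ζ : K) (b : ℕ → ℕ → Fin (p - 1) → ℤ) (q : ℕ × ℕ) :
    Submodule ℚ ((ZMod p)ˣ → K) :=
  (Submodule.span K (coeffVec p ζ b '' {q' | PairLE q' q})).restrictScalars ℚ ⊓
    LinearMap.range (nu p K)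

end Spaces

/-! ### Algorithms -/

/-- The `N × N` block of the entries `(n, h)`, `n, h < N`, of a double sequence of vectors. -/
def block (N : ℕ) (b : ℕ → ℕ → List ℤ) : List (List (List ℤ)) :=
  (List.range N).map fun n => (List.range N).map fun h => b n h

/-- `T` is given by an algorithm: from `p, x, y`, the position `(n, h)` and finitely many of the
input coefficients (the block whose size `N` is itself computed), a computable function returns the
new coefficient and the factor of the denominator at `(n, h)`. -/
def IsAlgorithm (T : ℕ → ℤ → ℤ → (ℕ → ℕ → List ℤ) → ℕ → ℕ → List ℤ × ℕ) : Prop :=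
  ∃ (N : (ℕ × ℤ × ℤ) × (ℕ × ℕ) → ℕ)
    (A : ((ℕ × ℤ × ℤ) × (ℕ × ℕ)) × List (List (List ℤ)) → List ℤ × ℕ),
    Computable N ∧ Computable A ∧
    ∀ p x y b n h,
      T p x y b n h = A (((p, x, y), (n, h)), block (N ((p, x, y), (n, h))) b)

end SuperFermat

end

/-! ### Primitive recursive integer arithmetic -/

namespace Primrec

/-! Only the block of coefficients with `n < p` and `h < width p x y` is changed, and no factor `p`
is needed in the denominators: `d = 1` and `e_n = 0` throughout. For `n < p` one has `c_n = p ^ n`.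
After multiplication by `(p x) ^ (p - 1)`, the term at `(n, h)` therefore carries the integer weight
`y ^ (n + h) (p x) ^ (p - 1 - n)`, and the sum is preserved as soon as the weighted changes add up
to zero in each coordinate.

The vectors are chosen level by level, a level being the set of pairs with `n + h = m`. Every weight
of level `m` is `y ^ m` times an integer prime to `y`. At level `m ≥ 1` there are at least two
vectors, tied by one congruence modulo `y`. This leaves enough freedom to keep each new vector
outside the span of the earlier ones, as long as that span is not the whole space
(`exists_pair_notMem`, `exists_level_notMem`, `exists_levels`). Level 0 has no freedom and keeps
`b_{0,0}`, which must be non-zero. Otherwise a prime `r ∣ y` would divide `ρ`, hence `γ`, hence `z ^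
w` in `ℤ_r[ζ]`, against coprimality (`IsDevelopment.exists_ne_zero`). After the levels below `p - 1`
an error `y ^ (p - 1) R` remains. Row `n = p - 1`, whose weights are pure powers of `y`, absorbs it
by carrying (`exists_sum_range_sub_mul_pow_eq`).

Computability comes from search. A certificate consists of the new block and an integral dual family
proving independence. Checking it is primitive recursive, and one always exists
(`exists_isCertificate`) because inputs that cannot arise from a solution are certified trivially.
So the search is total.

Independence over `ℚ` in `K` passes to independence over `K` of the Galois orbits by nondegeneracy
of the trace form (`linearIndependent_nu`). It follows that `U_q` is the image under `ν` of a
`ℚ`-span, which gives the dimensions and the strict inclusions. -/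

theorem int_natCast : Primrec (fun n : ℕ => (n : ℤ)) := by
  refine ((Primrec.ofNat ℤ).comp nat_double).of_eq fun n => ?_
  apply Encodable.encode_injective
  rw [Denumerable.encode_ofNat]
  rfl

theorem encode_int_natCast (n : ℕ) : Encodable.encode (n : ℤ) = 2 * n := rfl

theorem encode_int_negSucc (n : ℕ) : Encodable.encode (Int.negSucc n) = 2 * n + 1 := rfl

theorem int_neg : Primrec (fun z : ℤ => -z) := by
  -- The coding sends `n ≥ 0` to `2n` and `-(n + 1)` to `2n + 1`, so negation swaps `2n + 1` with
  -- `2n + 2`. Truncated subtraction fixes the code `0`.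
  have h : Primrec fun z : ℤ => Denumerable.ofNat ℤ
      (if Encodable.encode z % 2 = 0 then Encodable.encode z - 1 else Encodable.encode z + 1) :=
    (Primrec.ofNat ℤ).comp (Primrec.ite
      (Primrec.eq.comp (nat_mod.comp Primrec.encode (Primrec.const 2)) (Primrec.const 0))
      (nat_sub.comp Primrec.encode (Primrec.const 1)) (nat_add.comp Primrec.encode (Primrec.const 1)))
  refine h.of_eq fun z => ?_
  apply Encodable.encode_injective
  rw [Denumerable.encode_ofNat]
  rcases z with n | n
  · rcases n with _ | n
    · rfl
    · rw [Int.ofNat_eq_natCast, show -((n + 1 : ℕ) : ℤ) = Int.negSucc n from rfl,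
        encode_int_natCast, encode_int_negSucc, if_pos (by omega)]
      omega
  · rw [Int.neg_negSucc, encode_int_natCast, encode_int_negSucc]
    split_ifs <;> omega

theorem int_toNat : Primrec Int.toNat := by
  have h : Primrec fun z : ℤ =>
      if Encodable.encode z % 2 = 0 then Encodable.encode z / 2 else 0 :=
    Primrec.ite
      (Primrec.eq.comp (nat_mod.comp Primrec.encode (Primrec.const 2)) (Primrec.const 0))
      (nat_div.comp Primrec.encode (Primrec.const 2)) (Primrec.const 0)
  refine h.of_eq fun z => ?_
  rcases z with n | n
  · rw [Int.ofNat_eq_natCast, encode_int_natCast, Int.toNat_natCast]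
    split_ifs <;> omega
  · rw [encode_int_negSucc, Int.toNat_negSucc]
    split_ifs <;> omega

theorem int_subNat : Primrec₂ (fun a b : ℕ => (a : ℤ) - b) := by
  have h : Primrec₂ fun a b : ℕ => if b ≤ a then ((a - b : ℕ) : ℤ) else -((b - a : ℕ) : ℤ) :=
    Primrec.ite (nat_le.comp Primrec.snd Primrec.fst)
      (int_natCast.comp (nat_sub.comp Primrec.fst Primrec.snd))
      (int_neg.comp (int_natCast.comp (nat_sub.comp Primrec.snd Primrec.fst)))
  refine h.of_eq fun a b => ?_
  split_ifs <;> omega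

/-- An integer is the difference of its positive and negative parts, `z = z.toNat - (-z).toNat`,
which reduces the operation to natural numbers. The product below uses the same splitting. -/
theorem int_add : Primrec₂ (fun a b : ℤ => a + b) := by
  refine (int_subNat.comp₂
    (nat_add.comp₂ (int_toNat.comp₂ Primrec₂.left) (int_toNat.comp₂ Primrec₂.right))
    (nat_add.comp₂ (int_toNat.comp₂ (int_neg.comp₂ Primrec₂.left))
      (int_toNat.comp₂ (int_neg.comp₂ Primrec₂.right)))).of_eq fun a b => ?_
  omega

theorem int_sub : Primrec₂ (fun a b : ℤ => a - b) :=
  (int_add.comp₂ Primrec₂.left (int_neg.comp₂ Primrec₂.right)).of_eq fun a b =>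
    (sub_eq_add_neg a b).symm

theorem int_mul : Primrec₂ (fun a b : ℤ => a * b) := by
  have l : Primrec₂ fun a _ : ℤ => a.toNat := int_toNat.comp₂ Primrec₂.left
  have l' : Primrec₂ fun a _ : ℤ => (-a).toNat := int_toNat.comp₂ (int_neg.comp₂ Primrec₂.left)
  have r : Primrec₂ fun _ b : ℤ => b.toNat := int_toNat.comp₂ Primrec₂.right
  have r' : Primrec₂ fun _ b : ℤ => (-b).toNat := int_toNat.comp₂ (int_neg.comp₂ Primrec₂.right)
  refine (int_subNat.comp₂ (nat_add.comp₂ (nat_mul.comp₂ l r) (nat_mul.comp₂ l' r'))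
    (nat_add.comp₂ (nat_mul.comp₂ l r') (nat_mul.comp₂ l' r))).of_eq fun a b => ?_
  have ha : (a.toNat : ℤ) - ((-a).toNat : ℤ) = a := by omega
  have hb : (b.toNat : ℤ) - ((-b).toNat : ℤ) = b := by omega
  push_cast
  conv_rhs => rw [← ha, ← hb]
  ring

theorem int_natAbs : Primrec Int.natAbs := by
  refine (nat_add.comp int_toNat (int_toNat.comp int_neg)).of_eq fun z => ?_
  omega

theorem int_pow : Primrec₂ (fun (a : ℤ) (n : ℕ) => a ^ n) := by
  refine (Primrec.nat_rec (f := fun _ : ℤ => (1 : ℤ)) (g := fun (a : ℤ) (q : ℕ × ℤ) => q.2 * a)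
    (Primrec.const 1) (int_mul.comp₂ (Primrec.snd.comp₂ Primrec₂.right) Primrec₂.left)).of_eq
    fun a n => ?_
  induction n with
  | zero => simp
  | succ n ih => rw [pow_succ, ← ih]

theorem nat_pow' : Primrec₂ (fun (a n : ℕ) => a ^ n) := by
  refine (int_natAbs.comp₂ (int_pow.comp₂ (int_natCast.comp₂ Primrec₂.left) Primrec₂.right)).of_eq
    fun a n => ?_
  simp [Int.natAbs_pow]

variable {α : Type} [Primcodable α]

theorem sum_range {g : α → ℕ → ℤ} {f : α → ℕ} (hf : Primrec f)
    (hg : Primrec fun q : α × ℕ => g q.1 q.2) :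
    Primrec fun a => ∑ i ∈ Finset.range (f a), g a i := by
  have h : Primrec₂ fun (a : α) (q : ℕ × ℤ) => q.2 + g a q.1 :=
    int_add.comp (Primrec.snd.comp Primrec.snd)
      (hg.comp (Primrec.pair Primrec.fst (Primrec.fst.comp Primrec.snd)))
  refine (Primrec.nat_rec' hf (Primrec.const (0 : ℤ)) h).of_eq fun a => ?_
  induction f a with
  | zero => simp
  | succ n ih => rw [Finset.sum_range_succ, ← ih]

theorem forall_lt {R : α → ℕ → Prop} {f : α → ℕ} (hf : Primrec f)
    (hR : PrimrecPred fun q : α × ℕ => R q.1 q.2) : PrimrecPred fun a => ∀ n < f a, R a n := by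
  have h : PrimrecRel fun (n : ℕ) (a : α) => R a n :=
    (PrimrecPred.comp hR (Primrec.pair Primrec.snd Primrec.fst))
  exact (PrimrecRel.comp (g := fun a : α => a) h.forall_mem_list (list_range.comp hf)
    Primrec.id).of_eq fun a => by simp

theorem exists_lt {R : α → ℕ → Prop} {f : α → ℕ} (hf : Primrec f)
    (hR : PrimrecPred fun q : α × ℕ => R q.1 q.2) : PrimrecPred fun a => ∃ n < f a, R a n := by
  have h : PrimrecRel fun (n : ℕ) (a : α) => R a n :=
    (PrimrecPred.comp hR (Primrec.pair Primrec.snd Primrec.fst))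
  exact (PrimrecRel.comp (g := fun a : α => a) h.exists_mem_list (list_range.comp hf)
    Primrec.id).of_eq fun a => by simp

end Primrec

/-! ### The algorithm -/

/-- The one place where the algorithm leaves the primitive recursive functions: unbounded
minimisation is partial recursive, and `h` makes it total. -/
theorem Computable.nat_find {α : Type} [Primcodable α] {R : α → ℕ → Prop}
    [∀ a, DecidablePred (R a)] (hR : PrimrecPred fun q : α × ℕ => R q.1 q.2)
    (h : ∀ a, ∃ n, R a n) : Computable fun a => Nat.find (h a) := by
  have h1 : Partrec fun a => Nat.rfind fun n => Part.some (decide (R a n)) :=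
    Partrec.rfind (Computable.partrec (f := fun q : α × ℕ => decide (R q.1 q.2))
      (PrimrecPred.decide hR).to_comp)
  refine Partrec.of_eq_tot h1 fun a => ?_
  refine Nat.mem_rfind.2 ⟨?_, fun {m} hm => ?_⟩
  · exact Part.mem_some_iff.2 (decide_eq_true (Nat.find_spec (h a))).symm
  · exact Part.mem_some_iff.2 (decide_eq_false (Nat.find_min (h a) hm)).symm

namespace SuperFermat

/-- The entry of a block of vectors, with default value `0`. -/
def entry (B : List (List (List ℤ))) (n h i : ℕ) : ℤ := ((B.getD n []).getD h []).getD i 0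

/-- A list of integers read as a function of three arguments. -/
def readList (l : List ℤ) (n h i : ℕ) : ℤ := l.getD (Nat.pair n (Nat.pair h i)) 0

/-- The number of columns that the algorithm may have to modify. -/
def width (p : ℕ) (x y : ℤ) : ℕ :=
  p * (p * (2 * y.natAbs * y.natAbs ^ (2 * p) * (p * x.natAbs) ^ p)) + p + 1

/-- The position of the pair `(n, h)` in the order `⪯`, counted from `1`. -/
def pairRank (n h : ℕ) : ℕ := (n + h) * (n + h + 1) / 2 + h + 1

/-- `u` has coordinates smaller than `|y|`, and the sum of its series equals that of `b`. -/
def IsModification (p : ℕ) (x y : ℤ) (b u : ℕ → ℕ → ℕ → ℤ) : Prop :=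
  (∀ n < p, ∀ h < width p x y, ∀ i < p - 1, (u n h i).natAbs < y.natAbs) ∧
  ∀ i < p - 1, ∑ n ∈ Finset.range p, ∑ h ∈ Finset.range (width p x y),
    (u n h i - b n h i) * (y ^ (n + h) * ((p : ℤ) * x) ^ (p - 1 - n)) = 0

/-- `C` is, up to the factor `D`, a dual family of the family of the first `p - 1` vectors of `u`. -/
def IsDualFamily (p : ℕ) (u C : ℕ → ℕ → ℕ → ℤ) (D : ℤ) : Prop :=
  D ≠ 0 ∧ ∀ n < p, ∀ h < p, ∀ n' < p, ∀ h' < p, pairRank n h < p → pairRank n' h' < p →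
    ∑ i ∈ Finset.range (p - 1), C n h i * u n' h' i = if n = n' ∧ h = h' then D else 0

/-- The coefficients `b` do not come from a solution of the equation. -/
def IsIrregular (p : ℕ) (x y : ℤ) (b : ℕ → ℕ → ℕ → ℤ) : Prop :=
  p < 4 ∨ y.natAbs < 3 ∨
  (∃ g < y.natAbs + 1, 1 < g ∧ y.natAbs % g = 0 ∧ (p * x.natAbs) % g = 0) ∨
  (∃ n < p, ∃ h < width p x y, ∃ i < p - 1, y.natAbs < 2 * (b n h i).natAbs) ∨
  ∀ i < p - 1, b 0 0 i = 0

/-- The condition on `s` that the algorithm searches for. -/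
def IsCertificate (p : ℕ) (x y : ℤ) (b : ℕ → ℕ → ℕ → ℤ) (s : List ℤ × List ℤ × ℤ) : Prop :=
  IsIrregular p x y b ∨
    IsModification p x y b (readList s.1) ∧ IsDualFamily p (readList s.1) (readList s.2.1) s.2.2

section Primrec

variable {α : Type} [Primcodable α]

theorem primrec_entry : Primrec fun q : List (List (List ℤ)) × ℕ × ℕ × ℕ =>
    entry q.1 q.2.1 q.2.2.1 q.2.2.2 :=
  (Primrec.list_getD 0).comp ((Primrec.list_getD []).comp ((Primrec.list_getD []).comp
    Primrec.fst (Primrec.fst.comp Primrec.snd))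
    (Primrec.fst.comp (Primrec.snd.comp Primrec.snd)))
    (Primrec.snd.comp (Primrec.snd.comp Primrec.snd))

theorem primrec_readList : Primrec fun q : List ℤ × ℕ × ℕ × ℕ =>
    readList q.1 q.2.1 q.2.2.1 q.2.2.2 :=
  (Primrec.list_getD 0).comp Primrec.fst (Primrec₂.natPair.comp (Primrec.fst.comp Primrec.snd)
    (Primrec₂.natPair.comp (Primrec.fst.comp (Primrec.snd.comp Primrec.snd))
      (Primrec.snd.comp (Primrec.snd.comp Primrec.snd))))

theorem primrec_width {p : α → ℕ} {x y : α → ℤ} (hp : Primrec p) (hx : Primrec x)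
    (hy : Primrec y) : Primrec fun a => width (p a) (x a) (y a) := by
  have hx' := Primrec.int_natAbs.comp hx
  have hy' := Primrec.int_natAbs.comp hy
  have h := Primrec.nat_mul.comp (Primrec.nat_mul.comp (Primrec.nat_mul.comp (Primrec.const 2) hy')
    (Primrec.nat_pow'.comp hy' (Primrec.nat_mul.comp (Primrec.const 2) hp)))
    (Primrec.nat_pow'.comp (Primrec.nat_mul.comp hp hx') hp)
  exact Primrec.nat_add.comp (Primrec.nat_add.comp
    (Primrec.nat_mul.comp hp (Primrec.nat_mul.comp hp h)) hp) (Primrec.const 1)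

theorem primrec_pairRank {f g : α → ℕ} (hf : Primrec f) (hg : Primrec g) :
    Primrec fun a => pairRank (f a) (g a) := by
  have h := Primrec.nat_add.comp hf hg
  exact Primrec.nat_add.comp (Primrec.nat_add.comp (Primrec.nat_div.comp
    (Primrec.nat_mul.comp h (Primrec.nat_add.comp h (Primrec.const 1))) (Primrec.const 2)) hg)
    (Primrec.const 1)

variable {p : α → ℕ} {x y : α → ℤ} {b u C : α → ℕ → ℕ → ℕ → ℤ} {D : α → ℤ}

theorem primrecPred_isModification (hp : Primrec p) (hx : Primrec x) (hy : Primrec y)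
    (hb : Primrec fun q : α × ℕ × ℕ × ℕ => b q.1 q.2.1 q.2.2.1 q.2.2.2)
    (hu : Primrec fun q : α × ℕ × ℕ × ℕ => u q.1 q.2.1 q.2.2.1 q.2.2.2) :
    PrimrecPred fun a => IsModification (p a) (x a) (y a) (b a) (u a) := by
  have hp1 : Primrec fun a => p a - 1 := Primrec.nat_sub.comp hp (Primrec.const 1)
  have hw := primrec_width hp hx hy
  refine PrimrecPred.and ?_ ?_
  · refine Primrec.forall_lt hp (Primrec.forall_lt (hw.comp Primrec.fst)
      (Primrec.forall_lt (hp1.comp (Primrec.fst.comp Primrec.fst)) ?_))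
    have ha : Primrec fun q : ((α × ℕ) × ℕ) × ℕ => q.1.1.1 :=
      Primrec.fst.comp (Primrec.fst.comp Primrec.fst)
    exact Primrec.nat_lt.comp (Primrec.int_natAbs.comp (hu.comp (Primrec.pair ha
      (Primrec.pair (Primrec.snd.comp (Primrec.fst.comp Primrec.fst))
        (Primrec.pair (Primrec.snd.comp Primrec.fst) Primrec.snd)))))
      (Primrec.int_natAbs.comp (hy.comp ha))
  · refine Primrec.forall_lt hp1 (PrimrecRel.comp Primrec.eq (Primrec.sum_range
      (hp.comp Primrec.fst) (Primrec.sum_range (hw.comp (Primrec.fst.comp Primrec.fst)) ?_))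
      (Primrec.const 0))
    have ha : Primrec fun q : ((α × ℕ) × ℕ) × ℕ => q.1.1.1 :=
      Primrec.fst.comp (Primrec.fst.comp Primrec.fst)
    have hi : Primrec fun q : ((α × ℕ) × ℕ) × ℕ => q.1.1.2 :=
      Primrec.snd.comp (Primrec.fst.comp Primrec.fst)
    have hn : Primrec fun q : ((α × ℕ) × ℕ) × ℕ => q.1.2 := Primrec.snd.comp Primrec.fst
    have hh : Primrec fun q : ((α × ℕ) × ℕ) × ℕ => q.2 := Primrec.snd
    have hq := Primrec.pair ha (Primrec.pair hn (Primrec.pair hh hi))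
    exact Primrec.int_mul.comp (Primrec.int_sub.comp (hu.comp hq) (hb.comp hq))
      (Primrec.int_mul.comp (Primrec.int_pow.comp (hy.comp ha) (Primrec.nat_add.comp hn hh))
        (Primrec.int_pow.comp (Primrec.int_mul.comp (Primrec.int_natCast.comp (hp.comp ha))
          (hx.comp ha)) (Primrec.nat_sub.comp (hp1.comp ha) hn)))

theorem primrecPred_isDualFamily (hp : Primrec p)
    (hu : Primrec fun q : α × ℕ × ℕ × ℕ => u q.1 q.2.1 q.2.2.1 q.2.2.2)
    (hC : Primrec fun q : α × ℕ × ℕ × ℕ => C q.1 q.2.1 q.2.2.1 q.2.2.2) (hD : Primrec D) :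
    PrimrecPred fun a => IsDualFamily (p a) (u a) (C a) (D a) := by
  have h1 : Primrec fun q : α × ℕ => p q.1 := hp.comp Primrec.fst
  have h2 : Primrec fun q : (α × ℕ) × ℕ => p q.1.1 := h1.comp Primrec.fst
  have h3 : Primrec fun q : ((α × ℕ) × ℕ) × ℕ => p q.1.1.1 := h2.comp Primrec.fst
  have h4 : Primrec fun q : (((α × ℕ) × ℕ) × ℕ) × ℕ => p q.1.1.1.1 := h3.comp Primrec.fst
  have ha : Primrec fun q : (((α × ℕ) × ℕ) × ℕ) × ℕ => q.1.1.1.1 :=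
    Primrec.fst.comp (Primrec.fst.comp (Primrec.fst.comp Primrec.fst))
  have hn : Primrec fun q : (((α × ℕ) × ℕ) × ℕ) × ℕ => q.1.1.1.2 :=
    Primrec.snd.comp (Primrec.fst.comp (Primrec.fst.comp Primrec.fst))
  have hh : Primrec fun q : (((α × ℕ) × ℕ) × ℕ) × ℕ => q.1.1.2 :=
    Primrec.snd.comp (Primrec.fst.comp Primrec.fst)
  have hn' : Primrec fun q : (((α × ℕ) × ℕ) × ℕ) × ℕ => q.1.2 := Primrec.snd.comp Primrec.fst
  have hh' : Primrec fun q : (((α × ℕ) × ℕ) × ℕ) × ℕ => q.2 := Primrec.snd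
  have himp : ∀ {β : Type} [Primcodable β] {P Q R : β → Prop}, PrimrecPred P → PrimrecPred Q →
      PrimrecPred R → PrimrecPred fun a => P a → Q a → R a := fun hP hQ hR =>
    (hP.not.or (hQ.not.or hR)).of_eq fun a => by rw [imp_iff_not_or, imp_iff_not_or]
  have hCu : Primrec fun q : ((((α × ℕ) × ℕ) × ℕ) × ℕ) × ℕ =>
      C q.1.1.1.1.1 q.1.1.1.1.2 q.1.1.1.2 q.2 * u q.1.1.1.1.1 q.1.1.2 q.1.2 q.2 := by
    have hC' := hC.comp (g := fun q : ((((α × ℕ) × ℕ) × ℕ) × ℕ) × ℕ =>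
        (q.1.1.1.1.1, q.1.1.1.1.2, q.1.1.1.2, q.2)) (Primrec.pair (ha.comp Primrec.fst)
        (Primrec.pair (hn.comp Primrec.fst) (Primrec.pair (hh.comp Primrec.fst) Primrec.snd)))
    have hu' := hu.comp (g := fun q : ((((α × ℕ) × ℕ) × ℕ) × ℕ) × ℕ =>
        (q.1.1.1.1.1, q.1.1.2, q.1.2, q.2)) (Primrec.pair (ha.comp Primrec.fst)
        (Primrec.pair (hn'.comp Primrec.fst) (Primrec.pair (hh'.comp Primrec.fst) Primrec.snd)))
    exact Primrec.int_mul.comp hC' hu'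
  have hsum : Primrec fun q : (((α × ℕ) × ℕ) × ℕ) × ℕ => ∑ i ∈ Finset.range (p q.1.1.1.1 - 1),
      C q.1.1.1.1 q.1.1.1.2 q.1.1.2 i * u q.1.1.1.1 q.1.2 q.2 i :=
    Primrec.sum_range (f := fun q : (((α × ℕ) × ℕ) × ℕ) × ℕ => p q.1.1.1.1 - 1)
      (g := fun q i => C q.1.1.1.1 q.1.1.1.2 q.1.1.2 i * u q.1.1.1.1 q.1.2 q.2 i)
      (Primrec.nat_sub.comp h4 (Primrec.const 1)) hCu
  have hite : Primrec fun q : (((α × ℕ) × ℕ) × ℕ) × ℕ =>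
      if q.1.1.1.2 = q.1.2 ∧ q.1.1.2 = q.2 then D q.1.1.1.1 else 0 :=
    Primrec.ite (PrimrecPred.and (Primrec.eq.comp hn hn') (Primrec.eq.comp hh hh'))
      (hD.comp ha) (Primrec.const 0)
  have key : PrimrecPred fun q : (((α × ℕ) × ℕ) × ℕ) × ℕ =>
      (pairRank q.1.1.1.2 q.1.1.2 < p q.1.1.1.1 → pairRank q.1.2 q.2 < p q.1.1.1.1 →
        ∑ i ∈ Finset.range (p q.1.1.1.1 - 1),
          C q.1.1.1.1 q.1.1.1.2 q.1.1.2 i * u q.1.1.1.1 q.1.2 q.2 i =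
          if q.1.1.1.2 = q.1.2 ∧ q.1.1.2 = q.2 then D q.1.1.1.1 else 0) :=
    himp (Primrec.nat_lt.comp (primrec_pairRank hn hh) h4)
      (Primrec.nat_lt.comp (primrec_pairRank hn' hh') h4) (PrimrecRel.comp Primrec.eq hsum hite)
  exact PrimrecPred.and (PrimrecRel.comp Primrec.eq hD (Primrec.const 0)).not
    (Primrec.forall_lt hp (Primrec.forall_lt h1 (Primrec.forall_lt h2 (Primrec.forall_lt h3 key))))

theorem primrecPred_isIrregular (hp : Primrec p) (hx : Primrec x) (hy : Primrec y)
    (hb : Primrec fun q : α × ℕ × ℕ × ℕ => b q.1 q.2.1 q.2.2.1 q.2.2.2) :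
    PrimrecPred fun a => IsIrregular (p a) (x a) (y a) (b a) := by
  have hp1 : Primrec fun a => p a - 1 := Primrec.nat_sub.comp hp (Primrec.const 1)
  have hw := primrec_width hp hx hy
  have hx' := Primrec.int_natAbs.comp hx
  have hy' := Primrec.int_natAbs.comp hy
  refine PrimrecPred.or (Primrec.nat_lt.comp hp (Primrec.const 4)) (PrimrecPred.or
    (Primrec.nat_lt.comp hy' (Primrec.const 3)) (PrimrecPred.or ?_ (PrimrecPred.or ?_ ?_)))
  · exact Primrec.exists_lt (Primrec.nat_add.comp hy' (Primrec.const 1)) (PrimrecPred.and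
      (Primrec.nat_lt.comp (Primrec.const 1) Primrec.snd) (PrimrecPred.and
      (PrimrecRel.comp Primrec.eq (Primrec.nat_mod.comp (hy'.comp Primrec.fst) Primrec.snd)
        (Primrec.const 0))
      (PrimrecRel.comp Primrec.eq (Primrec.nat_mod.comp ((Primrec.nat_mul.comp hp hx').comp
        Primrec.fst) Primrec.snd) (Primrec.const 0))))
  · refine Primrec.exists_lt hp (Primrec.exists_lt (hw.comp Primrec.fst)
      (Primrec.exists_lt (hp1.comp (Primrec.fst.comp Primrec.fst)) ?_))
    have ha : Primrec fun q : ((α × ℕ) × ℕ) × ℕ => q.1.1.1 :=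
      Primrec.fst.comp (Primrec.fst.comp Primrec.fst)
    exact Primrec.nat_lt.comp (hy'.comp ha) (Primrec.nat_mul.comp (Primrec.const 2)
      (Primrec.int_natAbs.comp (hb.comp (Primrec.pair ha
      (Primrec.pair (Primrec.snd.comp (Primrec.fst.comp Primrec.fst))
        (Primrec.pair (Primrec.snd.comp Primrec.fst) Primrec.snd))))))
  · exact Primrec.forall_lt hp1 (PrimrecRel.comp Primrec.eq (hb.comp (Primrec.pair Primrec.fst
      (Primrec.pair (Primrec.const 0) (Primrec.pair (Primrec.const 0) Primrec.snd))))
      (Primrec.const 0))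

theorem primrecPred_isCertificate {s : α → List ℤ × List ℤ × ℤ}
    (hp : Primrec p) (hx : Primrec x) (hy : Primrec y)
    (hb : Primrec fun q : α × ℕ × ℕ × ℕ => b q.1 q.2.1 q.2.2.1 q.2.2.2) (hs : Primrec s) :
    PrimrecPred fun a => IsCertificate (p a) (x a) (y a) (b a) (s a) := by
  have hu : Primrec fun q : α × ℕ × ℕ × ℕ => readList (s q.1).1 q.2.1 q.2.2.1 q.2.2.2 :=
    primrec_readList.comp (Primrec.pair (Primrec.fst.comp (hs.comp Primrec.fst)) Primrec.snd)
  have hC : Primrec fun q : α × ℕ × ℕ × ℕ => readList (s q.1).2.1 q.2.1 q.2.2.1 q.2.2.2 :=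
    primrec_readList.comp (Primrec.pair
      (Primrec.fst.comp (Primrec.snd.comp (hs.comp Primrec.fst))) Primrec.snd)
  exact PrimrecPred.or (primrecPred_isIrregular hp hx hy hb)
    (PrimrecPred.and (primrecPred_isModification hp hx hy hb hu)
      (primrecPred_isDualFamily hp hu hC (Primrec.snd.comp (Primrec.snd.comp hs))))

end Primrec

theorem exists_code (h : ∀ p x y b, ∃ s, IsCertificate p x y b s)
    (p : ℕ) (x y : ℤ) (b : ℕ → ℕ → ℕ → ℤ) :
    ∃ k, IsCertificate p x y b (Denumerable.ofNat (List ℤ × List ℤ × ℤ) k) := by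
  obtain ⟨s, hs⟩ := h p x y b
  exact ⟨Encodable.encode s, by rwa [Denumerable.ofNat_encode]⟩

open Classical in
/-- The first code of a certificate for the coefficients `b`. -/
noncomputable def searchCode (h : ∀ p x y b, ∃ s, IsCertificate p x y b s)
    (p : ℕ) (x y : ℤ) (b : ℕ → ℕ → ℕ → ℤ) : ℕ :=
  Nat.find (exists_code h p x y b)

theorem isCertificate_searchCode (h : ∀ p x y b, ∃ s, IsCertificate p x y b s)
    (p : ℕ) (x y : ℤ) (b : ℕ → ℕ → ℕ → ℤ) :
    IsCertificate p x y b
      (Denumerable.ofNat (List ℤ × List ℤ × ℤ) (searchCode h p x y b)) := by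
  classical
  exact Nat.find_spec (exists_code h p x y b)

/-- The new coefficient at `(n, h)`, computed from a block. -/
noncomputable def newCoeff (hc : ∀ p x y b, ∃ s, IsCertificate p x y b s)
    (q : ((ℕ × ℤ × ℤ) × (ℕ × ℕ)) × List (List (List ℤ))) : List ℤ × ℕ :=
  -- In both branches the second component, the factor of the denominator, is `1`.
  if q.1.2.1 < q.1.1.1 ∧ q.1.2.2 < width q.1.1.1 q.1.1.2.1 q.1.1.2.2 then
    ((List.range (q.1.1.1 - 1)).map
      (readList (Denumerable.ofNat (List ℤ × List ℤ × ℤ)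
        (searchCode hc q.1.1.1 q.1.1.2.1 q.1.1.2.2 (entry q.2))).1 q.1.2.1 q.1.2.2), 1)
  else ((q.2.getD q.1.2.1 []).getD q.1.2.2 [], 1)

theorem computable_newCoeff (hc : ∀ p x y b, ∃ s, IsCertificate p x y b s) :
    Computable (newCoeff hc) := by
  have hpxy : Primrec fun q : ((ℕ × ℤ × ℤ) × (ℕ × ℕ)) × List (List (List ℤ)) => q.1.1 :=
    Primrec.fst.comp Primrec.fst
  have hnh : Primrec fun q : ((ℕ × ℤ × ℤ) × (ℕ × ℕ)) × List (List (List ℤ)) => q.1.2 :=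
    Primrec.snd.comp Primrec.fst
  have hp := Primrec.fst.comp hpxy
  have hx := Primrec.fst.comp (Primrec.snd.comp hpxy)
  have hy := Primrec.snd.comp (Primrec.snd.comp hpxy)
  have hn := Primrec.fst.comp hnh
  have hh := Primrec.snd.comp hnh
  have hB : Primrec fun q : ((ℕ × ℤ × ℤ) × (ℕ × ℕ)) × List (List (List ℤ)) => q.2 := Primrec.snd
  have hcode : Computable fun q : ((ℕ × ℤ × ℤ) × (ℕ × ℕ)) × List (List (List ℤ)) =>
      searchCode hc q.1.1.1 q.1.1.2.1 q.1.1.2.2 (entry q.2) := by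
    classical
    have hb : Primrec fun r : ((((ℕ × ℤ × ℤ) × (ℕ × ℕ)) × List (List (List ℤ))) × ℕ) ×
        ℕ × ℕ × ℕ => entry r.1.1.2 r.2.1 r.2.2.1 r.2.2.2 :=
      primrec_entry.comp (g := fun r : ((((ℕ × ℤ × ℤ) × (ℕ × ℕ)) × List (List (List ℤ))) × ℕ) ×
        ℕ × ℕ × ℕ => (r.1.1.2, r.2))
        (Primrec.pair (hB.comp (Primrec.fst.comp Primrec.fst)) Primrec.snd)
    have hs : Primrec fun r : (((ℕ × ℤ × ℤ) × (ℕ × ℕ)) × List (List (List ℤ))) × ℕ =>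
        Denumerable.ofNat (List ℤ × List ℤ × ℤ) r.2 := (Primrec.ofNat _).comp Primrec.snd
    have hR := primrecPred_isCertificate
      (b := fun r : (((ℕ × ℤ × ℤ) × (ℕ × ℕ)) × List (List (List ℤ))) × ℕ => entry r.1.2)
      (hp.comp Primrec.fst) (hx.comp Primrec.fst) (hy.comp Primrec.fst) hb hs
    exact (Computable.nat_find (R := fun q k => IsCertificate q.1.1.1 q.1.1.2.1 q.1.1.2.2
      (entry q.2) (Denumerable.ofNat (List ℤ × List ℤ × ℤ) k)) hR
      fun q => exists_code hc _ _ _ _).of_eq fun q => by unfold searchCode; congr!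
  have hout : Primrec fun r : (((ℕ × ℤ × ℤ) × (ℕ × ℕ)) × List (List (List ℤ))) × ℕ =>
      if r.1.1.2.1 < r.1.1.1.1 ∧ r.1.1.2.2 < width r.1.1.1.1 r.1.1.1.2.1 r.1.1.1.2.2 then
        ((List.range (r.1.1.1.1 - 1)).map (readList (Denumerable.ofNat (List ℤ × List ℤ × ℤ)
          r.2).1 r.1.1.2.1 r.1.1.2.2), 1)
      else ((r.1.2.getD r.1.1.2.1 []).getD r.1.1.2.2 [], 1) := by
    have hl : Primrec fun t : ((((ℕ × ℤ × ℤ) × (ℕ × ℕ)) × List (List (List ℤ))) × ℕ) × ℕ =>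
        readList (Denumerable.ofNat (List ℤ × List ℤ × ℤ) t.1.2).1 t.1.1.1.2.1 t.1.1.1.2.2 t.2 :=
      primrec_readList.comp
        (g := fun t : ((((ℕ × ℤ × ℤ) × (ℕ × ℕ)) × List (List (List ℤ))) × ℕ) × ℕ =>
          ((Denumerable.ofNat (List ℤ × List ℤ × ℤ) t.1.2).1, t.1.1.1.2.1, t.1.1.1.2.2, t.2))
        (Primrec.pair (Primrec.fst.comp ((Primrec.ofNat _).comp (Primrec.snd.comp Primrec.fst)))
          (Primrec.pair (hn.comp (Primrec.fst.comp Primrec.fst))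
            (Primrec.pair (hh.comp (Primrec.fst.comp Primrec.fst)) Primrec.snd)))
    have hm : Primrec fun r : (((ℕ × ℤ × ℤ) × (ℕ × ℕ)) × List (List (List ℤ))) × ℕ =>
        (List.range (r.1.1.1.1 - 1)).map (readList (Denumerable.ofNat (List ℤ × List ℤ × ℤ)
          r.2).1 r.1.1.2.1 r.1.1.2.2) :=
      Primrec.list_map (f := fun r : (((ℕ × ℤ × ℤ) × (ℕ × ℕ)) × List (List (List ℤ))) × ℕ =>
        List.range (r.1.1.1.1 - 1)) (Primrec.list_range.comp (Primrec.nat_sub.comp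
        (hp.comp Primrec.fst) (Primrec.const 1))) hl
    exact Primrec.ite ((PrimrecPred.and (Primrec.nat_lt.comp hn hp)
      (Primrec.nat_lt.comp hh (primrec_width hp hx hy))).comp Primrec.fst)
      (Primrec.pair hm (Primrec.const 1))
      (Primrec.pair (((Primrec.list_getD []).comp ((Primrec.list_getD []).comp hB hn) hh).comp
        Primrec.fst) (Primrec.const 1))
  exact (hout.to_comp.comp (Computable.pair Computable.id hcode)).of_eq fun q => rfl

end SuperFermat

/-! ### Modification of the digits -/

namespace SuperFermat

/-- The integer `t` is added to the digits with carries. Since `2|B 0| ≤ |y|` and `|y| ≥ 3`, the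
carry out of a position is strictly smaller in absolute value than a non-zero carry into it. Hence
it dies within `|t|` positions, and `k > |t|` columns suffice. -/
theorem exists_sum_range_sub_mul_pow_eq {y : ℤ} (hy : 3 ≤ |y|) (k : ℕ) :
    ∀ (t : ℤ) (B : ℕ → ℤ), |t| < k → (∀ h < k, 2 * |B h| ≤ |y|) →
      ∃ c : ℕ → ℤ, (∀ h < k, |c h| < |y|) ∧
        ∑ h ∈ Finset.range k, (c h - B h) * y ^ h = t := by
  induction k with
  | zero =>
    intro t B ht
    have := abs_nonneg t
    norm_num at ht
    omega
  | succ k ih =>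
    intro t B ht hB
    by_cases h0 : t = 0
    · refine ⟨B, fun h hh => ?_, by simp [h0]⟩
      have := hB h hh
      have := abs_nonneg (B h)
      omega
    have hy0 : y ≠ 0 := by rintro rfl; simp at hy
    -- Division truncated towards zero gives `|y| * |q| ≤ |B 0 + t|` for either sign; rounding down
    -- would not.
    obtain ⟨q, r, hqr, hr⟩ : ∃ q r : ℤ, B 0 + t = r + y * q ∧ |r| < |y| ∧ |y| * |q| ≤ |B 0 + t| := by
      refine ⟨(B 0 + t).tdiv y, (B 0 + t).tmod y, (Int.tmod_add_mul_tdiv _ _).symm, ?_, ?_⟩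
      · rw [Int.abs_eq_natAbs, Int.abs_eq_natAbs, Int.natAbs_tmod]
        exact_mod_cast Nat.mod_lt _ (Int.natAbs_pos.2 hy0)
      · rw [Int.abs_eq_natAbs, Int.abs_eq_natAbs, Int.abs_eq_natAbs, Int.natAbs_tdiv]
        exact_mod_cast Nat.mul_div_le _ _
    have hq : |q| < k := by
      have h1 := hB 0 (by omega)
      have h2 := abs_add_le (B 0) t
      have h3 : 1 ≤ |t| := Int.one_le_abs h0
      push_cast at ht
      by_contra hcon
      have h4 : |t| ≤ |q| := by omega
      nlinarith
    obtain ⟨c, hc, hsum⟩ := ih q (fun h => B (h + 1)) hq fun h hh => hB _ (by omega)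
    refine ⟨fun h => Nat.casesOn h r c, fun h hh => ?_, ?_⟩
    · rcases h with _ | h
      · exact hr.1
      · exact hc h (by omega)
    · rw [Finset.sum_range_succ']
      simp only [pow_succ, pow_zero, mul_one, ← mul_assoc]
      rw [← Finset.sum_mul, hsum]
      change q * y + (r - B 0) = t
      linarith

/-- An integer vector as a rational vector. -/
def toRat {d : ℕ} (v : Fin d → ℤ) : Fin d → ℚ := fun i => (v i : ℚ)

theorem exists_dvd_sub_abs_lt {y : ℤ} (hy : y ≠ 0) {c : ℤ} (hc : IsCoprime c y) (t : ℤ) :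
    ∃ r : ℤ, |r| < |y| ∧ y ∣ t - c * r := by
  obtain ⟨a, b, hab⟩ := hc
  refine ⟨(a * t) % y, ?_, ?_⟩
  · rw [abs_of_nonneg (Int.emod_nonneg _ hy)]
    exact Int.emod_lt_abs _ hy
  · have h := Int.emod_add_mul_ediv (a * t) y
    refine ⟨b * t + c * (a * t / y), ?_⟩
    linear_combination (-t) * hab - c * h

section

variable {d : ℕ}

theorem exists_single_notMem {W : Submodule ℚ (Fin d → ℚ)} (hW : Module.finrank ℚ W < d) :
    ∃ i, (Pi.single i 1 : Fin d → ℚ) ∉ W := by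
  by_contra! h
  have : W = ⊤ := by
    rw [eq_top_iff, ← (Pi.basisFun ℚ (Fin d)).span_eq, Submodule.span_le]
    rintro _ ⟨i, rfl⟩
    simpa using h i
  rw [this, finrank_top] at hW
  simp at hW

theorem finrank_sup_span_singleton_le (W : Submodule ℚ (Fin d → ℚ)) (v : Fin d → ℚ) :
    Module.finrank ℚ ↥(W ⊔ Submodule.span ℚ {v}) ≤ Module.finrank ℚ W + 1 := by
  have h := Submodule.finrank_add_le_finrank_add_finrank W (Submodule.span ℚ {v})
  have h' : Module.finrank ℚ ↥(Submodule.span ℚ {v}) ≤ 1 := 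
    (finrank_span_le_card ({v} : Set (Fin d → ℚ))).trans (by simp)
  omega

theorem toRat_single (i : Fin d) : toRat (Pi.single i 1) = Pi.single i 1 := by
  ext j
  by_cases h : j = i
  · subst h; simp [toRat]
  · simp [toRat, h]

/-- The idea is to take `u = e_i + s e_j`, with `e_i` outside `W` and `e_j` outside `W + ⟨e_i⟩`, and
to solve the congruence for `v`. A non-zero coordinate `v_j` has two admissible representatives,
differing by `|y|`. The two resulting vectors differ by a multiple of `e_j`, which is not in `W +
⟨u⟩`, so one of them lies outside that space. When the dimension of `W` leaves no room, the
corresponding claim is void. -/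
theorem exists_pair_notMem (W : Submodule ℚ (Fin d → ℚ)) {y c c' : ℤ} (hy : 2 ≤ |y|)
    (hc : IsCoprime c y) (hc' : IsCoprime c' y) (V : Fin d → ℤ) :
    ∃ u v : Fin d → ℤ, (∀ i, |u i| < |y|) ∧ (∀ i, |v i| < |y|) ∧
      (∀ i, y ∣ V i - (c * u i + c' * v i)) ∧
      (Module.finrank ℚ W < d → toRat u ∉ W) ∧
      (Module.finrank ℚ W + 1 < d → toRat v ∉ W ⊔ Submodule.span ℚ {toRat u}) := by
  have hy0 : y ≠ 0 := by rintro rfl; simp at hy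
  have hrep : ∀ u : Fin d → ℤ, ∃ v : Fin d → ℤ, (∀ i, |v i| < |y|) ∧
      ∀ i, y ∣ V i - (c * u i + c' * v i) := by
    intro u
    choose v hv using fun i => exists_dvd_sub_abs_lt hy0 hc' (V i - c * u i)
    exact ⟨v, fun i => (hv i).1, fun i => by simpa [sub_sub] using (hv i).2⟩
  have hs : ∀ i j : Fin d, |(Pi.single i 1 : Fin d → ℤ) j| ≤ 1 := by
    intro i j
    by_cases h : j = i
    · subst h; simp
    · simp [h]
  by_cases h1 : Module.finrank ℚ W < d
  swap
  · obtain ⟨v, hv⟩ := hrep 0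
    exact ⟨0, v, fun i => by simpa using hy0, hv.1, hv.2, fun h => absurd h h1,
      fun h => absurd h (by omega)⟩
  obtain ⟨i, hi⟩ := exists_single_notMem h1
  by_cases h2 : Module.finrank ℚ W + 1 < d
  swap
  · obtain ⟨v, hv⟩ := hrep (Pi.single i 1)
    exact ⟨_, v, fun j => by linarith [hs i j], hv.1, hv.2, fun _ => by rwa [toRat_single],
      fun h => absurd h h2⟩
  obtain ⟨j, hj⟩ := exists_single_notMem (lt_of_le_of_lt
    (finrank_sup_span_singleton_le W (Pi.single i 1)) h2)
  have hij : j ≠ i := by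
    rintro rfl
    exact hj (Submodule.mem_sup_right (Submodule.mem_span_singleton_self _))
  -- The vectors `e_i` and `e_j` are independent modulo `W`, hence so are `e_i + s e_j` and `e_j`.
  -- The cases distinguish whether the coefficient of `e_j` cancels.
  have hj' : ∀ s : ℤ, (Pi.single j 1 : Fin d → ℚ) ∉
      W ⊔ Submodule.span ℚ {toRat (Pi.single i 1 + s • Pi.single j 1)} := by
    intro s hmem
    have e : toRat (Pi.single i 1 + s • Pi.single j 1 : Fin d → ℤ) =
        Pi.single i 1 + (s : ℚ) • Pi.single j 1 := by
      rw [← toRat_single, ← toRat_single]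
      ext k
      simp [toRat]
    rw [e] at hmem
    obtain ⟨w, hw, z, hz, hwz⟩ := Submodule.mem_sup.1 hmem
    obtain ⟨q, rfl⟩ := Submodule.mem_span_singleton.1 hz
    by_cases hq : 1 - q * s = 0
    · have hq0 : q ≠ 0 := by rintro rfl; simp at hq
      apply hi
      have : (Pi.single i 1 : Fin d → ℚ) = q⁻¹ • (-w) := by
        rw [eq_inv_smul_iff₀ hq0]
        rw [smul_add, smul_smul, show q * s = 1 by linarith, one_smul] at hwz
        linear_combination (exp := 1) hwz
      rw [this]
      exact W.smul_mem _ (W.neg_mem hw)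
    · apply hj
      have : (Pi.single j 1 : Fin d → ℚ) =
          (1 - q * s)⁻¹ • w + ((1 - q * s)⁻¹ * q) • Pi.single i 1 := by
        rw [← smul_smul, ← smul_add, eq_inv_smul_iff₀ hq, sub_smul, one_smul, ← smul_smul]
        nth_rewrite 1 [← hwz]
        rw [smul_add]
        abel
      rw [this]
      exact Submodule.add_mem _ (Submodule.mem_sup_left (W.smul_mem _ hw))
        (Submodule.mem_sup_right (Submodule.smul_mem _ _ (Submodule.mem_span_singleton_self _)))
  -- This choice of `s` forces `v_j ≠ 0`: with `v_j = 0` the congruence would give `y ∣ V_j - c s`.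
  -- One of `s = 0, 1` avoids this because `c` is prime to `y`.
  obtain ⟨s, hs1, hsV⟩ : ∃ s : ℤ, (s = 0 ∨ s = 1) ∧ ¬ y ∣ V j - c * s := by
    by_cases h3 : y ∣ V j
    · refine ⟨1, Or.inr rfl, fun h4 => ?_⟩
      have h5 : y ∣ c := by simpa using dvd_sub h3 h4
      have h6 := Int.isUnit_iff_abs_eq.1 (hc.isUnit_of_dvd' h5 dvd_rfl)
      omega
    · exact ⟨0, Or.inl rfl, by simpa using h3⟩
  set u : Fin d → ℤ := Pi.single i 1 + s • Pi.single j 1 with hu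
  have huj : u j = s := by simp [hu, hij]
  have hub : ∀ k, |u k| < |y| := by
    intro k
    have : |u k| ≤ 1 := by
      by_cases hk : k = j
      · rw [hk, huj]
        rcases hs1 with rfl | rfl <;> simp
      · simpa [hu, hk] using hs i k
    omega
  have huW : toRat u ∉ W := by
    intro h
    apply hi
    have hjW := hj' s
    rw [← hu] at hjW
    by_contra hi'
    rcases hs1 with rfl | rfl
    · apply hi
      simpa [hu, toRat_single] using h
    · have hb := hj' 1
      apply hj
      have e : toRat u = Pi.single i 1 + Pi.single j 1 := by
        rw [hu, ← toRat_single, ← toRat_single]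
        ext k
        simp [toRat]
      have : (Pi.single j 1 : Fin d → ℚ) = toRat u + (-1 : ℚ) • Pi.single i 1 := by
        rw [e]; simp
      rw [this]
      exact Submodule.add_mem _ (Submodule.mem_sup_left h)
        (Submodule.mem_sup_right (Submodule.smul_mem _ _ (Submodule.mem_span_singleton_self _)))
  obtain ⟨v, hvb, hvd⟩ := hrep u
  by_cases hv : toRat v ∈ W ⊔ Submodule.span ℚ {toRat u}
  swap
  · exact ⟨u, v, hub, hvb, hvd, fun _ => huW, fun _ => hv⟩
  have hvj : v j ≠ 0 := by
    intro h
    have := hvd j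
    rw [huj, h, mul_zero, add_zero] at this
    exact hsV this
  -- The coordinate is moved by `|y|` towards the side opposite to its sign, so it stays in the open
  -- interval `(-|y|, |y|)`. For `v_j = 0` no such move exists.
  obtain ⟨z, hz0, hzy, hzb⟩ : ∃ z : ℤ, z ≠ 0 ∧ y ∣ z ∧ |v j + z| < |y| := by
    have h3 := hvb j
    have h4 := abs_pos.2 hvj
    rcases lt_or_gt_of_ne hvj with h | h
    · refine ⟨|y|, by simpa using hy0, (dvd_abs _ _).2 dvd_rfl, ?_⟩
      rw [abs_lt] at h3 ⊢
      omega
    · refine ⟨-|y|, by simpa using hy0, (dvd_neg.2 ((dvd_abs _ _).2 dvd_rfl)), ?_⟩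
      rw [abs_lt] at h3 ⊢
      omega
  refine ⟨u, v + z • Pi.single j 1, hub, fun k => ?_, fun k => ?_, fun _ => huW, fun _ h => ?_⟩
  · by_cases hk : k = j
    · subst hk; simpa using hzb
    · simpa [hk] using hvb k
  · have : V k - (c * u k + c' * (v + z • Pi.single j 1 : Fin d → ℤ) k) =
        (V k - (c * u k + c' * v k)) - z * (c' * (Pi.single j 1 : Fin d → ℤ) k) := by
      simp only [Pi.add_apply, Pi.smul_apply, smul_eq_mul]
      ring
    rw [this]
    exact dvd_sub (hvd k) (hzy.mul_right _)
  · apply hj' s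
    rw [← hu]
    have : (Pi.single j 1 : Fin d → ℚ) =
        (z : ℚ)⁻¹ • (toRat (v + z • Pi.single j 1) - toRat v) := by
      rw [eq_inv_smul_iff₀ (by exact_mod_cast hz0), ← toRat_single]
      ext k
      simp [toRat]
    rw [this]
    exact Submodule.smul_mem _ _ (Submodule.sub_mem _ h hv)

/-- The congruence only constrains the last two vectors, which come from `exists_pair_notMem`. The
first `k` are free: standard basis vectors outside the span so far, or `0` once the independence
claim is void. -/
theorem exists_level_notMem {y : ℤ} (hy : 2 ≤ |y|) (k : ℕ) :
    ∀ (W : Submodule ℚ (Fin d → ℚ)) (w : ℕ) (c : ℕ → ℤ) (V : Fin d → ℤ),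
      Module.finrank ℚ W ≤ w → (∀ h, IsCoprime (c h) y) →
      ∃ u : ℕ → Fin d → ℤ, (∀ h i, |u h i| < |y|) ∧
        (∀ i, y ∣ V i - ∑ h ∈ Finset.range (k + 2), c h * u h i) ∧
        ∀ h < k + 2, w + h + 1 ≤ d →
          toRat (u h) ∉ W ⊔ Submodule.span ℚ ((fun h => toRat (u h)) '' {h' | h' < h}) := by
  have hy0 : y ≠ 0 := by rintro rfl; simp at hy
  induction k with
  | zero =>
    intro W w c V hW hc
    obtain ⟨u, v, hu, hv, hd, h1, h2⟩ := exists_pair_notMem W hy (hc 0) (hc 1) V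
    refine ⟨fun h => if h = 0 then u else v, fun h i => ?_, fun i => ?_, fun h hh hd => ?_⟩
    · dsimp only
      split_ifs
      exacts [hu i, hv i]
    · simpa [Finset.sum_range_succ] using hd i
    · interval_cases h
      · simpa using h1 (by omega)
      · have : {h' : ℕ | h' < 1} = {0} := by ext; simp
        rw [this, Set.image_singleton]
        simpa using h2 (by omega)
  | succ k ih =>
    intro W w c V hW hc
    obtain ⟨u₀, hu₀, hu₀W⟩ : ∃ u₀ : Fin d → ℤ, (∀ i, |u₀ i| < |y|) ∧
        (w + 1 ≤ d → toRat u₀ ∉ W) := by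
      by_cases h1 : w + 1 ≤ d
      · obtain ⟨i, hi⟩ := exists_single_notMem (W := W) (by omega)
        refine ⟨Pi.single i 1, fun j => ?_, fun _ => by rwa [toRat_single]⟩
        by_cases h : j = i
        · subst h; simp; omega
        · simpa [h] using hy0
      · exact ⟨0, fun i => by simpa using hy0, fun h => absurd h h1⟩
    obtain ⟨u, hu, hd, hn⟩ := ih (W ⊔ Submodule.span ℚ {toRat u₀}) (w + 1) (fun h => c (h + 1))
      (fun i => V i - c 0 * u₀ i) ((finrank_sup_span_singleton_le _ _).trans (by omega))
      fun h => hc _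
    refine ⟨fun h => Nat.casesOn h u₀ u, fun h i => ?_, fun i => ?_, fun h hh hd => ?_⟩
    · rcases h with _ | h
      exacts [hu₀ i, hu h i]
    · rw [Finset.sum_range_succ']
      have := hd i
      rw [sub_sub, add_comm (c 0 * u₀ i)] at this
      exact this
    · rcases h with _ | h
      · simpa using hu₀W (by omega)
      · convert hn h (by omega) (by omega) using 2
        rw [sup_assoc, ← Submodule.span_union]
        congr 2
        ext v
        simp only [Set.mem_image, Set.mem_ofPred_eq, Set.singleton_union, Set.mem_insert_iff]
        constructor
        · rintro ⟨h' | h', hlt, rfl⟩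
          · exact Or.inl rfl
          · exact Or.inr ⟨h', by omega, rfl⟩
        · rintro (rfl | ⟨h', hlt, rfl⟩)
          · exact ⟨0, by omega, rfl⟩
          · exact ⟨h' + 1, by omega, rfl⟩

end

end SuperFermat

/-! ### Ranks of index pairs, dual families, and the choice of vectors level by level. -/

namespace SuperFermat

theorem triangle_succ (m : ℕ) : (m + 1) * (m + 1 + 1) / 2 = m * (m + 1) / 2 + (m + 1) := by
  rw [show (m + 1) * (m + 1 + 1) = m * (m + 1) + (m + 1) * 2 by ring,
    Nat.add_mul_div_right _ _ (by norm_num)]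

theorem triangle_mono {m n : ℕ} (h : m ≤ n) : m * (m + 1) / 2 ≤ n * (n + 1) / 2 :=
  Nat.div_le_div_right (Nat.mul_le_mul h (by omega))

theorem pairRank_lt_of_lt {n h n' h' : ℕ} (hlt : n' + h' < n + h ∨ n' + h' = n + h ∧ h' < h) :
    pairRank n' h' < pairRank n h := by
  unfold pairRank
  rcases hlt with hlt | ⟨heq, hlt⟩
  · have h1 := triangle_mono (show n' + h' + 1 ≤ n + h from hlt)
    have h2 := triangle_succ (n' + h')
    omega
  · rw [heq]
    omega

theorem pairRank_lt_iff {n h n' h' : ℕ} :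
    pairRank n' h' < pairRank n h ↔ n' + h' < n + h ∨ n' + h' = n + h ∧ h' < h := by
  refine ⟨fun hlt => ?_, pairRank_lt_of_lt⟩
  by_contra hcon
  have h1 : (n + h < n' + h' ∨ n + h = n' + h' ∧ h < h') ∨ (n = n' ∧ h = h') := by omega
  rcases h1 with h1 | ⟨rfl, rfl⟩
  · exact absurd hlt (pairRank_lt_of_lt h1).le.not_gt
  · exact lt_irrefl _ hlt

theorem pairRank_injective : Function.Injective fun q : ℕ × ℕ => pairRank q.1 q.2 := by
  rintro ⟨n, h⟩ ⟨n', h'⟩ heq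
  have h1 := pairRank_lt_iff (n := n) (h := h) (n' := n') (h' := h')
  have h2 := pairRank_lt_iff (n := n') (h := h') (n' := n) (h' := h)
  simp only at heq
  rw [heq] at h1 h2
  simp only [lt_self_iff_false, false_iff] at h1 h2
  ext <;> simp only <;> omega

theorem add_lt_pairRank (n h : ℕ) : n + h < pairRank n h := by
  unfold pairRank
  rcases Nat.eq_zero_or_pos (n + h) with h0 | h0
  · omega
  · have := triangle_succ (n + h - 1)
    rw [Nat.sub_add_cancel h0] at this
    omega

/-- In a non-trivial relation, the term of largest rank with non-zero coefficient would lie in the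
span of the vectors of smaller rank. -/
theorem linearIndependent_of_notMem_span {ι E : Type*} [AddCommGroup E] [Module ℚ E]
    {r : ι → ℕ} (hr : Function.Injective r) {v : ι → E}
    (h : ∀ i, v i ∉ Submodule.span ℚ (v '' {j | r j < r i})) : LinearIndependent ℚ v := by
  classical
  rw [linearIndependent_iff']
  by_contra! hcon
  obtain ⟨s, g, hg, i₀, hi₀, hgi₀⟩ := hcon
  obtain ⟨i, hi, hmax⟩ := Finset.exists_max_image (s.filter fun i => g i ≠ 0) r
    ⟨i₀, by simp [hi₀, hgi₀]⟩
  simp only [Finset.mem_filter] at hi hmax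
  apply h i
  have hv : v i = (-(g i)⁻¹) • ∑ j ∈ s.erase i, g j • v j := by
    rw [← Finset.add_sum_erase _ _ hi.1] at hg
    rw [← neg_eq_of_add_eq_zero_right hg, smul_neg, neg_smul, neg_neg, smul_smul,
      inv_mul_cancel₀ hi.2, one_smul]
  rw [hv]
  refine Submodule.smul_mem _ _ (Submodule.sum_mem _ fun j hj => ?_)
  rw [Finset.mem_erase] at hj
  by_cases hgj : g j = 0
  · simp [hgj]
  · exact Submodule.smul_mem _ _ (Submodule.subset_span ⟨j, lt_of_le_of_ne (hmax j ⟨hj.2, hgj⟩)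
      fun he => hj.1 (hr he), rfl⟩)

/-- A linear left inverse of the combination map yields a rational dual family, and `D` clears its
denominators. This turns independence into finitely many integer identities, which the algorithm can
check. -/
theorem exists_dual {ι : Type*} [Finite ι] [DecidableEq ι] {d : ℕ} {v : ι → Fin d → ℤ}
    (h : LinearIndependent ℚ fun q => toRat (v q)) :
    ∃ (C : ι → Fin d → ℤ) (D : ℤ), D ≠ 0 ∧
      ∀ q q', ∑ i, C q i * v q' i = if q = q' then D else 0 := by
  obtain ⟨g, hg⟩ := LinearMap.exists_leftInverse_of_injective _
    (LinearMap.ker_eq_bot.2 h.finsuppLinearCombination_injective)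
  have hgv : ∀ q q', ∑ i, g (Pi.single i 1) q * v q' i = if q = q' then 1 else 0 := by
    intro q q'
    have h1 := LinearMap.congr_fun hg (Finsupp.single q' 1)
    simp only [LinearMap.comp_apply, Finsupp.linearCombination_single, one_smul,
      LinearMap.id_apply] at h1
    have h2 : toRat (v q') = ∑ i, (v q' i : ℚ) • (Pi.single i 1 : Fin d → ℚ) := by
      ext j
      simp [toRat, Finset.sum_apply, Pi.single_apply]
    rw [h2, map_sum] at h1
    have h3 := DFunLike.congr_fun h1 q
    rw [Finsupp.finsetSum_apply, Finsupp.single_apply] at h3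
    simp only [eq_comm (a := q') (b := q)] at h3
    rw [← h3]
    exact Finset.sum_congr rfl fun i _ => by simp [mul_comm]
  obtain ⟨D, hD⟩ := IsLocalization.exist_integer_multiples_of_finite (nonZeroDivisors ℤ)
    (fun q : ι × Fin d => g (Pi.single q.2 1) q.1)
  choose C hC using hD
  refine ⟨fun q i => C (q, i), D, nonZeroDivisors.ne_zero D.2, fun q q' => ?_⟩
  have h4 : ((∑ i, C (q, i) * v q' i : ℤ) : ℚ) = (((if q = q' then (D : ℤ) else 0) : ℤ) : ℚ) := by
    push_cast
    have h5 : ∀ i, (C (q, i) : ℚ) = (D : ℤ) * g (Pi.single i 1) q := fun i => by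
      have := hC (q, i)
      simpa [Algebra.smul_def, Submonoid.smul_def] using this
    simp only [h5, mul_assoc]
    rw [← Finset.mul_sum, hgv]
    split_ifs <;> simp
  exact_mod_cast h4

/-- The positions in the levels before `(m, h)`, a position being a level with a column. -/
def positionsBefore (m h : ℕ) : Set (ℕ × ℕ) :=
  {q | q.1 < m ∧ q.2 ≤ q.1 ∨ q.1 = m ∧ q.2 < h}

/-- If the total change below level `M` is `y ^ M R`, then divisibility by `y ^ (M + 1)` is a single
congruence modulo `y` on the vectors of level `M`, with coefficients `κ` prime to `y`. Vectors of
earlier levels are never revised. -/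
theorem exists_levels {d : ℕ} {y : ℤ} (hy : 2 ≤ |y|) {κ : ℕ → ℤ} (hκ : ∀ n, IsCoprime (κ n) y)
    {B : ℕ → ℕ → Fin d → ℤ} (hB : ∀ i, |B 0 0 i| < |y|) (hB0 : B 0 0 ≠ 0) (M : ℕ) :
    ∃ U : ℕ → ℕ → Fin d → ℤ, (∀ m < M, ∀ h ≤ m, ∀ i, |U m h i| < |y|) ∧
      (∀ i, y ^ M ∣ ∑ m ∈ Finset.range M, ∑ h ∈ Finset.range (m + 1),
        (U m h i - B m h i) * (y ^ m * κ (m - h))) ∧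
      ∀ m < M, ∀ h ≤ m, m * (m + 1) / 2 + h + 1 ≤ d →
        toRat (U m h) ∉ Submodule.span ℚ
          ((fun q : ℕ × ℕ => toRat (U q.1 q.2)) '' positionsBefore m h) := by
  induction M with
  | zero => exact ⟨B, by simp, by simp, by simp⟩
  | succ M ih =>
    obtain ⟨U, hU, hdvd, hspan⟩ := ih
    choose R hR using hdvd
    set W := Submodule.span ℚ ((fun q : ℕ × ℕ => toRat (U q.1 q.2)) '' positionsBefore M 0) with hW
    -- The earlier levels hold `1 + 2 + ⋯ + M` vectors, so the bound `w` of `exists_level_notMem`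
    -- can be taken as this triangular number, and `w + h + 1` is the rank of position `h` in level
    -- `M`.
    have hWle : Module.finrank ℚ W ≤ M * (M + 1) / 2 := by
      have h1 : ((fun q : ℕ × ℕ => toRat (U q.1 q.2)) '' positionsBefore M 0) =
          ((((Finset.range M).sigma fun m => Finset.range (m + 1)).image
            fun q => toRat (U q.1 q.2) : Finset (Fin d → ℚ)) : Set (Fin d → ℚ)) := by
        ext v
        simp [positionsBefore]
      rw [hW, h1]
      refine (finrank_span_finset_le_card _).trans (Finset.card_image_le.trans ?_)
      rw [Finset.card_sigma]
      simp only [Finset.card_range]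
      clear hU hR hspan hW h1
      induction M with
      | zero => simp
      | succ M ih' => rw [Finset.sum_range_succ, triangle_succ]; omega
    obtain ⟨u, hu, hud, hun⟩ : ∃ u : ℕ → Fin d → ℤ, (∀ h i, |u h i| < |y|) ∧
        (∀ i, y ∣ R i + ∑ h ∈ Finset.range (M + 1), (u h i - B M h i) * κ (M - h)) ∧
        ∀ h ≤ M, M * (M + 1) / 2 + h + 1 ≤ d →
          toRat (u h) ∉ W ⊔ Submodule.span ℚ ((fun h => toRat (u h)) '' {h' | h' < h}) := by
      rcases M with _ | M
      -- Level 0 has a single vector, fixed by its congruence up to multiples of `y`; the old one is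
      -- kept, and `hB0` gives its independence. Every later level has the two vectors that
      -- `exists_level_notMem` needs.
      · refine ⟨fun _ => B 0 0, fun _ => hB, fun i => ?_, fun h hh _ => ?_⟩
        · have := hR i
          simp at this
          simp [← this]
        · obtain rfl : h = 0 := by omega
          have hW0 : W = ⊥ := by simp [hW, positionsBefore]
          rw [hW0]
          simp only [not_lt_zero, Set.ofPred_false, Set.image_empty, Submodule.span_empty,
            bot_sup_eq, Submodule.mem_bot]
          intro h0
          apply hB0
          ext i
          have := congrFun h0 i
          simpa [toRat] using this
      · obtain ⟨u, hu, hud, hun⟩ := exists_level_notMem hy M W _ (fun h => κ (M + 1 - h))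
          (fun i => -R i + ∑ h ∈ Finset.range (M + 1 + 1), κ (M + 1 - h) * B (M + 1) h i) hWle
          fun h => hκ _
        refine ⟨u, hu, fun i => ?_, fun h hh => hun h (by omega)⟩
        have := hud i
        have e : ∑ h ∈ Finset.range (M + 1 + 1), (u h i - B (M + 1) h i) * κ (M + 1 - h) =
            ∑ h ∈ Finset.range (M + 1 + 1), κ (M + 1 - h) * u h i -
              ∑ h ∈ Finset.range (M + 1 + 1), κ (M + 1 - h) * B (M + 1) h i := by
          rw [← Finset.sum_sub_distrib]
          exact Finset.sum_congr rfl fun h _ => by ring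
        rw [e, ← dvd_neg]
        have e' : ∀ r s t : ℤ, -(r + (s - t)) = -r + t - s := fun r s t => by ring
        rw [e']
        exact this
    refine ⟨fun m => if m = M then u else U m, fun m hm h hh i => ?_, fun i => ?_,
      fun m hm h hh hd => ?_⟩
    · dsimp only
      split_ifs with hmM
      exacts [hu h i, hU m (by omega) h hh i]
    · rw [Finset.sum_range_succ]
      have h1 : ∑ m ∈ Finset.range M, ∑ h ∈ Finset.range (m + 1),
          ((if m = M then u else U m) h i - B m h i) * (y ^ m * κ (m - h)) = y ^ M * R i := by
        rw [← hR i]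
        refine Finset.sum_congr rfl fun m hm => ?_
        rw [if_neg (Finset.mem_range.1 hm).ne]
      have h2 : ∑ h ∈ Finset.range (M + 1), ((if M = M then u else U M) h i - B M h i) *
          (y ^ M * κ (M - h)) =
          y ^ M * ∑ h ∈ Finset.range (M + 1), (u h i - B M h i) * κ (M - h) := by
        rw [if_pos rfl, Finset.mul_sum]
        exact Finset.sum_congr rfl fun h _ => by ring
      rw [h1, h2, ← mul_add, pow_succ]
      exact mul_dvd_mul_left _ (hud i)
    · dsimp only
      by_cases hmM : m = M
      · subst hmM
        rw [if_pos rfl]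
        convert hun h hh hd using 2
        rw [hW, ← Submodule.span_union]
        congr 1
        ext v
        constructor
        · rintro ⟨q, ⟨hq, hq'⟩ | ⟨hq, hq'⟩, rfl⟩
          · left
            exact ⟨q, Or.inl ⟨hq, hq'⟩, by simp [hq.ne]⟩
          · right
            exact ⟨q.2, hq', by simp [hq]⟩
        · rintro (⟨q, ⟨hq, hq'⟩ | ⟨hq, hq'⟩, rfl⟩ | ⟨h', hh', rfl⟩)
          · exact ⟨q, Or.inl ⟨hq, hq'⟩, by simp [hq.ne]⟩
          · omega
          · exact ⟨(m, h'), Or.inr ⟨rfl, hh'⟩, by simp⟩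
      · rw [if_neg hmM]
        convert hspan m (by omega) h hh hd using 3
        refine Set.image_congr fun q hq => ?_
        have : q.1 ≠ M := by
          rcases hq with hq | hq <;> omega
        simp [this]

theorem exists_readList_eq (f : ℕ → ℕ → ℕ → ℤ) (M : ℕ) :
    ∃ l : List ℤ, ∀ n < M, ∀ h < M, ∀ i < M, readList l n h i = f n h i := by
  refine ⟨(List.range (Nat.pair M (Nat.pair M M))).map fun t =>
    f t.unpair.1 t.unpair.2.unpair.1 t.unpair.2.unpair.2, fun n hn h hh i hi => ?_⟩
  have hlt : Nat.pair n (Nat.pair h i) < Nat.pair M (Nat.pair M M) :=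
    (Nat.pair_lt_pair_left _ hn).trans (Nat.pair_lt_pair_right _
      ((Nat.pair_lt_pair_left _ hh).trans (Nat.pair_lt_pair_right _ hi)))
  simp [readList, List.getD_eq_getElem?_getD, hlt]

end SuperFermat

/-! ### Existence of a certificate for every input. -/

namespace SuperFermat

theorem sum_triangle (f : ℕ → ℕ → ℤ) {L w : ℕ} (hw : L ≤ w) :
    ∑ n ∈ Finset.range L, ∑ h ∈ Finset.range w, (if n + h < L then f n h else 0) =
      ∑ m ∈ Finset.range L, ∑ h ∈ Finset.range (m + 1), f (m - h) h := by
  rw [← Finset.sum_product', ← Finset.sum_filter (p := fun q : ℕ × ℕ => q.1 + q.2 < L),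
    Finset.sum_sigma' (t := fun m => Finset.range (m + 1))]
  refine Finset.sum_nbij' (fun q => ⟨q.1 + q.2, q.2⟩) (fun q => (q.1 - q.2, q.2)) ?_ ?_ ?_ ?_ ?_
  · rintro ⟨n, h⟩ hq
    simp at hq ⊢
    omega
  · rintro ⟨n, h⟩ hq
    simp at hq ⊢
    omega
  · rintro ⟨n, h⟩ hq
    simp
  · rintro ⟨n, h⟩ hq
    simp at hq ⊢
    omega
  · rintro ⟨n, h⟩ hq
    simp

theorem exists_isDualFamily {p : ℕ} {U : ℕ → ℕ → Fin (p - 1) → ℤ}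
    (hU : ∀ m < p - 1, ∀ h ≤ m, m * (m + 1) / 2 + h + 1 ≤ p - 1 →
      toRat (U m h) ∉ Submodule.span ℚ
        ((fun q : ℕ × ℕ => toRat (U q.1 q.2)) '' positionsBefore m h)) {u : ℕ → ℕ → ℕ → ℤ}
    (hu : ∀ n h, pairRank n h < p → ∀ i : Fin (p - 1), u n h i = U (n + h) h i) :
    ∃ C D, IsDualFamily p u C D := by
  classical
  let ι := {q : ℕ × ℕ // pairRank q.1 q.2 < p}
  have hr : Function.Injective fun q : ι => pairRank q.1.1 q.1.2 :=
    pairRank_injective.comp Subtype.val_injective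
  have : Finite ι := Finite.of_injective (fun q : ι => (⟨pairRank q.1.1 q.1.2, q.2⟩ : Fin p))
    fun q q' h => hr (Fin.mk.inj_iff.1 h)
  have hli : LinearIndependent ℚ fun q : ι => toRat (U (q.1.1 + q.1.2) q.1.2) := by
    refine linearIndependent_of_notMem_span hr fun q hq => ?_
    have hlt := add_lt_pairRank q.1.1 q.1.2
    have hq2 := q.2
    refine hU (q.1.1 + q.1.2) (by omega) q.1.2 (by omega) (by unfold pairRank at hq2; omega) ?_
    refine Submodule.span_mono ?_ hq
    rintro _ ⟨q', hq', rfl⟩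
    refine ⟨(q'.1.1 + q'.1.2, q'.1.2), ?_, rfl⟩
    rcases pairRank_lt_iff.1 hq' with h | h
    · exact Or.inl ⟨h, by simp⟩
    · exact Or.inr h
  obtain ⟨C, D, hD, hC⟩ := exists_dual hli
  refine ⟨fun n h i => if hi : pairRank n h < p ∧ i < p - 1 then C ⟨(n, h), hi.1⟩ ⟨i, hi.2⟩ else 0,
    D, hD, fun n _ h _ n' _ h' _ hlt hlt' => ?_⟩
  have h1 := hC ⟨(n, h), hlt⟩ ⟨(n', h'), hlt'⟩
  rw [Finset.sum_range]
  have h2 : (⟨(n, h), hlt⟩ : ι) = ⟨(n', h'), hlt'⟩ ↔ n = n' ∧ h = h' :=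
    Subtype.ext_iff.trans Prod.ext_iff
  simp only [h2] at h1
  rw [← h1]
  refine Finset.sum_congr rfl fun i _ => ?_
  dsimp only
  rw [dif_pos ⟨hlt, i.2⟩, hu n' h' hlt']

/-- The pairs of level below `p - 1` are replaced through `exists_levels`, and the remaining error
`y ^ (p - 1) R i` is cancelled by carrying along row `n = p - 1`. Every pair of rank below `p` has
level below `p - 1`, so the carrying does not disturb independence. -/
theorem exists_isModification {p : ℕ} {x y : ℤ} (hp : 4 ≤ p) (hy : 3 ≤ |y|)
    (hcop : IsCoprime ((p : ℤ) * x) y) {b : ℕ → ℕ → ℕ → ℤ}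
    (hb : ∀ n < p, ∀ h < width p x y, ∀ i < p - 1, 2 * |b n h i| ≤ |y|)
    (hb0 : ∃ i < p - 1, b 0 0 i ≠ 0) :
    ∃ u C D, IsModification p x y b u ∧ IsDualFamily p u C D := by
  have hy0 : y ≠ 0 := by rintro rfl; simp at hy
  have ha0 : (p : ℤ) * x ≠ 0 := by
    intro h0
    rw [h0, isCoprime_zero_left, Int.isUnit_iff_abs_eq] at hcop
    omega
  have hpw : p < width p x y := by unfold width; omega
  have hblt : ∀ n < p, ∀ h < width p x y, ∀ i < p - 1, |b n h i| < |y| := fun n hn h hh i hi => by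
    have := hb n hn h hh i hi
    have := abs_nonneg (b n h i)
    omega
  obtain ⟨U, hU, hdvd, hspan⟩ := exists_levels (d := p - 1) (y := y) (by omega)
    (κ := fun n => ((p : ℤ) * x) ^ (p - 1 - n)) (fun n => hcop.pow_left)
    (B := fun m h i => b (m - h) h i)
    (fun i => hblt 0 (by omega) 0 (by omega) i i.2)
    (by
      obtain ⟨i, hi, hne⟩ := hb0
      exact fun h => hne (congrFun h ⟨i, hi⟩)) (p - 1)
  choose R hR using hdvd
  -- `width` is made to exceed this crude bound: at most `p` levels with at most `p` terms each,
  -- every term being at most `2|y| |y| ^ (2p) |p x| ^ p`. It bounds the carry, hence the number of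
  -- columns that the carrying needs.
  have hRlt : ∀ i, |-R i| < (width p x y : ℤ) := by
    intro i
    have h1 : |y ^ (p - 1) * R i| ≤ p * (p * (2 * |y| * |y| ^ (2 * p) * |(p : ℤ) * x| ^ p)) := by
      rw [← hR i]
      have hT : ∀ m ∈ Finset.range (p - 1), |∑ h ∈ Finset.range (m + 1),
          (U m h i - b (m - h) h i) * (y ^ m * ((p : ℤ) * x) ^ (p - 1 - (m - h)))| ≤
          p * (2 * |y| * |y| ^ (2 * p) * |(p : ℤ) * x| ^ p) := by
        intro m hm
        rw [Finset.mem_range] at hm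
        refine (Finset.abs_sum_le_sum_abs _ _).trans ?_
        have : ∀ h ∈ Finset.range (m + 1),
            |(U m h i - b (m - h) h i) * (y ^ m * ((p : ℤ) * x) ^ (p - 1 - (m - h)))| ≤
            2 * |y| * |y| ^ (2 * p) * |(p : ℤ) * x| ^ p := by
          intro h hh
          rw [Finset.mem_range] at hh
          rw [abs_mul, abs_mul, abs_pow, abs_pow, ← mul_assoc]
          have h2 := hU m hm h (by omega) i
          have h3 := hblt (m - h) (by omega) h (by omega) i i.2
          have h4 := abs_sub (U m h i) (b (m - h) h i)
          have h5 : |y| ^ m ≤ |y| ^ (2 * p) := pow_le_pow_right₀ (by omega) (by omega)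
          have h6 : |(p : ℤ) * x| ^ (p - 1 - (m - h)) ≤ |(p : ℤ) * x| ^ p :=
            pow_le_pow_right₀ (Int.one_le_abs ha0) (by omega)
          have h7 : |U m h i - b (m - h) h i| ≤ 2 * |y| := by omega
          gcongr
        refine (Finset.sum_le_card_nsmul _ _ _ this).trans ?_
        rw [Finset.card_range, nsmul_eq_mul]
        gcongr
        omega
      refine (Finset.abs_sum_le_sum_abs _ _).trans ((Finset.sum_le_card_nsmul _ _ _ hT).trans ?_)
      rw [Finset.card_range, nsmul_eq_mul]
      gcongr
      omega
    have h2 : |R i| ≤ |y ^ (p - 1) * R i| := by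
      rw [abs_mul]
      exact le_mul_of_one_le_left (abs_nonneg _) (Int.one_le_abs (pow_ne_zero _ hy0))
    rw [abs_neg]
    have h3 : (width p x y : ℤ) =
        p * (p * (2 * |y| * |y| ^ (2 * p) * |(p : ℤ) * x| ^ p)) + p + 1 := by
      simp [width, abs_mul]
    omega
  choose c hc hcsum using fun i : Fin (p - 1) => exists_sum_range_sub_mul_pow_eq hy (width p x y)
    (-R i) (fun h => b (p - 1) h i) (hRlt i) fun h hh => hb _ (by omega) h hh i i.2
  -- The two modified regions are disjoint, because row `p - 1` only meets levels `≥ p - 1`.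
  set u : ℕ → ℕ → ℕ → ℤ := fun n h i => if hi : i < p - 1 then
    (if n + h < p - 1 then U (n + h) h ⟨i, hi⟩ else if n = p - 1 then c ⟨i, hi⟩ h else b n h i)
    else 0 with hu
  obtain ⟨C, D, hCD⟩ := exists_isDualFamily hspan (u := u) fun n h hlt i => by
    have := add_lt_pairRank n h
    simp only [hu]
    rw [dif_pos i.2, if_pos (by omega)]
  refine ⟨u, C, D, ⟨fun n hn h hh i hi => ?_, fun i hi => ?_⟩, hCD⟩
  · have : |u n h i| < |y| := by
      simp only [hu]
      rw [dif_pos hi]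
      split_ifs with h1 h2
      · exact hU _ h1 _ (by omega) _
      · exact hc _ h hh
      · exact hblt n hn h hh i hi
    rwa [Int.abs_eq_natAbs, Int.abs_eq_natAbs, Nat.cast_lt] at this
  · obtain ⟨L, rfl⟩ : ∃ L, p = L + 1 := ⟨p - 1, by omega⟩
    simp only [Nat.add_sub_cancel] at *
    rw [Finset.sum_range_succ]
    have h1 : ∑ h ∈ Finset.range (width (L + 1) x y), (u L h i - b L h i) *
        (y ^ (L + h) * (((L + 1 : ℕ) : ℤ) * x) ^ (L - L)) = y ^ L * -R ⟨i, hi⟩ := by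
      rw [← hcsum ⟨i, hi⟩, Finset.mul_sum]
      refine Finset.sum_congr rfl fun h _ => ?_
      simp only [hu]
      rw [dif_pos hi, if_neg (by omega), if_pos trivial, pow_add, Nat.sub_self, pow_zero]
      ring
    have h2 : ∑ n ∈ Finset.range L, ∑ h ∈ Finset.range (width (L + 1) x y), (u n h i - b n h i) *
        (y ^ (n + h) * (((L + 1 : ℕ) : ℤ) * x) ^ (L - n)) = y ^ L * R ⟨i, hi⟩ := by
      rw [← hR ⟨i, hi⟩]
      have h3 := sum_triangle (fun n h => (U (n + h) h ⟨i, hi⟩ - b n h i) *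
        (y ^ (n + h) * (((L + 1 : ℕ) : ℤ) * x) ^ (L - n))) (L := L) (w := width (L + 1) x y)
        (by omega)
      refine Eq.trans ?_ (h3.trans ?_)
      · refine Finset.sum_congr rfl fun n hn => Finset.sum_congr rfl fun h _ => ?_
        have := Finset.mem_range.1 hn
        simp only [hu]
        rw [dif_pos hi]
        split_ifs
        · rfl
        · omega
        · simp
      · refine Finset.sum_congr rfl fun m hm => Finset.sum_congr rfl fun h hh => ?_
        have := Finset.mem_range.1 hh
        rw [Nat.sub_add_cancel (by omega)]
    rw [h1, h2]
    ring

/-- The search must halt on arbitrary input, also on data that come from no solution. Such data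
either fail one of the decidable conditions used by `exists_isModification`, and are then certified
by `IsIrregular`, or satisfy them all and are treated like genuine data. -/
theorem exists_isCertificate (p : ℕ) (x y : ℤ) (b : ℕ → ℕ → ℕ → ℤ) :
    ∃ s, IsCertificate p x y b s := by
  by_cases hirr : IsIrregular p x y b
  · exact ⟨default, Or.inl hirr⟩
  unfold IsIrregular at hirr
  push Not at hirr
  obtain ⟨hp, hy, hg, hb, hb0⟩ := hirr
  have hcop : IsCoprime ((p : ℤ) * x) y := by
    rw [Int.isCoprime_iff_gcd_eq_one]
    by_contra hne
    have h1 : Int.gcd (p * x) y ∣ y.natAbs := Int.gcd_dvd_natAbs_right _ _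
    have h2 : Int.gcd (p * x) y ∣ p * x.natAbs := by
      simpa [Int.natAbs_mul] using Int.gcd_dvd_natAbs_left (p * x) y
    have h3 := Nat.le_of_dvd (by omega) h1
    have h4 : Int.gcd (p * x) y ≠ 0 := fun h0 => by
      rw [h0, zero_dvd_iff] at h1
      omega
    exact hg _ (by omega) (by omega) (Nat.mod_eq_zero_of_dvd h1) (Nat.mod_eq_zero_of_dvd h2)
  obtain ⟨u, C, D, hu, hC⟩ := exists_isModification hp
    (by rw [Int.abs_eq_natAbs]; omega) hcop (fun n hn h hh i hi => by
      have := hb n hn h hh i hi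
      rw [Int.abs_eq_natAbs, Int.abs_eq_natAbs]
      omega) hb0
  obtain ⟨l, hl⟩ := exists_readList_eq u (width p x y)
  obtain ⟨l', hl'⟩ := exists_readList_eq C (width p x y)
  have hpw : p < width p x y := by unfold width; omega
  refine ⟨(l, l', D), Or.inr ⟨⟨fun n hn h hh i hi => ?_, fun i hi => ?_⟩, hC.1,
    fun n hn h hh n' hn' h' hh' hr hr' => ?_⟩⟩
  · rw [hl n (by omega) h hh i (by omega)]
    exact hu.1 n hn h hh i hi
  · rw [← hu.2 i hi]
    refine Finset.sum_congr rfl fun n hn => Finset.sum_congr rfl fun h hh => ?_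
    rw [Finset.mem_range] at hn hh
    rw [hl n (by omega) h hh i (by omega)]
  · rw [← hC.2 n hn h hh n' hn' h' hh' hr hr']
    refine Finset.sum_congr rfl fun i hi => ?_
    rw [Finset.mem_range] at hi
    rw [hl n' (by omega) h' (by omega) i (by omega), hl' n (by omega) h (by omega) i (by omega)]

end SuperFermat

namespace SuperFermat

/-! ### The order of the pairs -/

theorem pairLE_iff {q q' : ℕ × ℕ} : PairLE q q' ↔ pairRank q.1 q.2 ≤ pairRank q'.1 q'.2 := by
  rw [← not_lt, pairRank_lt_iff]
  unfold PairLE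
  omega

theorem pairLT_iff {q q' : ℕ × ℕ} : PairLT q q' ↔ pairRank q.1 q.2 < pairRank q'.1 q'.2 := by
  unfold PairLT
  rw [pairLE_iff, lt_iff_le_and_ne]
  exact and_congr_right fun _ => not_congr pairRank_injective.eq_iff.symm

theorem exists_pairRank_eq (k : ℕ) : ∃ q : ℕ × ℕ, pairRank q.1 q.2 = k + 1 := by
  induction k with
  | zero => exact ⟨(0, 0), rfl⟩
  | succ k ih =>
    obtain ⟨⟨n, h⟩, hq⟩ := ih
    rcases n with _ | n
    · refine ⟨(h + 1, 0), ?_⟩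
      have := triangle_succ h
      simp only [pairRank, zero_add, add_zero] at *
      omega
    · refine ⟨(n, h + 1), ?_⟩
      simp only [pairRank] at *
      rw [show n + (h + 1) = n + 1 + h by ring]
      omega

theorem Omega_eq (q : ℕ × ℕ) : Omega q = pairRank q.1 q.2 := by
  unfold Omega
  rw [← Set.ncard_image_of_injective _ pairRank_injective]
  have : (fun q : ℕ × ℕ => pairRank q.1 q.2) '' {q' | PairLE q' q} =
      ((Finset.Icc 1 (pairRank q.1 q.2) : Finset ℕ) : Set ℕ) := by
    ext k
    simp only [Set.mem_image, Set.mem_ofPred_eq, Finset.coe_Icc, Set.mem_Icc, pairLE_iff]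
    constructor
    · rintro ⟨q', hq', rfl⟩
      exact ⟨by unfold pairRank; omega, hq'⟩
    · rintro ⟨h1, h2⟩
      obtain ⟨q', hq'⟩ := exists_pairRank_eq (k - 1)
      rw [Nat.sub_add_cancel h1] at hq'
      exact ⟨q', hq'.trans_le h2, hq'⟩
  rw [this, Set.ncard_coe_finset, Nat.card_Icc]
  omega

theorem finite_pairLE (q : ℕ × ℕ) : {q' : ℕ × ℕ | PairLE q' q}.Finite := by
  refine Set.Finite.of_finite_image ((Set.finite_Iic (pairRank q.1 q.2)).subset ?_)
    pairRank_injective.injOn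
  rintro _ ⟨q', hq', rfl⟩
  exact pairLE_iff.1 hq'

/-! ### Galois orbits of linearly independent families -/

theorem linearIndependent_pow_succ (p : ℕ) [Fact p.Prime] {K : Type*} [Field K] [NumberField K]
    {ζ : K} (hζ : IsPrimitiveRoot ζ p) :
    LinearIndependent ℚ fun i : Fin (p - 1) => ζ ^ ((i : ℕ) + 1) := by
  have hp : p.Prime := Fact.out
  have hdeg : (minpoly ℚ ζ).natDegree = p - 1 := by
    rw [← Polynomial.cyclotomic_eq_minpoly_rat hζ hp.pos, Polynomial.natDegree_cyclotomic,
      Nat.totient_prime hp]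
  have h1 : LinearIndependent ℚ fun i : Fin (p - 1) => ζ ^ (i : ℕ) := by
    have := linearIndependent_pow (K := ℚ) ζ
    rwa [hdeg] at this
  have h2 := h1.map' (LinearMap.mulLeft ℚ ζ) (LinearMap.ker_eq_bot.2
    (mul_right_injective₀ (hζ.ne_zero hp.ne_zero)))
  have e : (fun i : Fin (p - 1) => ζ ^ ((i : ℕ) + 1)) =
      LinearMap.mulLeft ℚ ζ ∘ fun i : Fin (p - 1) => ζ ^ (i : ℕ) := by
    funext i
    simp [pow_succ']
  rw [e]
  exact h2

theorem linearIndependent_ofCoords (p : ℕ) [Fact p.Prime] {K : Type*} [Field K] [NumberField K]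
    {ζ : K} {b : ℕ → ℕ → Fin (p - 1) → ℤ} {q : ℕ × ℕ} (hζ : IsPrimitiveRoot ζ p) {u C : ℕ → ℕ → ℕ → ℤ} {D : ℤ}
    (hu : IsDualFamily p u C D)
    (hb : ∀ n h, pairRank n h < p → ∀ i : Fin (p - 1), b n h i = u n h i)
    (hq : pairRank q.1 q.2 < p) :
    LinearIndependent ℚ fun i : {q' : ℕ × ℕ // PairLE q' q} => ofCoords ζ (b i.1.1 i.1.2) := by
  classical
  rw [linearIndependent_iff']
  intro s g hg r hr
  have hrank : ∀ r : {q' : ℕ × ℕ // PairLE q' q}, pairRank r.1.1 r.1.2 < p := fun r =>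
    (pairLE_iff.1 r.2).trans_lt hq
  have hcoord : ∀ i : Fin (p - 1), ∑ t ∈ s, g t * (b t.1.1 t.1.2 i : ℚ) = 0 := by
    have hli := linearIndependent_pow_succ p hζ
    rw [Fintype.linearIndependent_iff] at hli
    refine hli (fun i => ∑ t ∈ s, g t * (b t.1.1 t.1.2 i : ℚ)) ?_
    rw [← hg]
    simp only [ofCoords, Finset.sum_smul, Finset.smul_sum]
    rw [Finset.sum_comm]
    refine Finset.sum_congr rfl fun t _ => Finset.sum_congr rfl fun i _ => ?_
    rw [mul_smul, Algebra.smul_def (b t.1.1 t.1.2 i : ℚ), map_intCast]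
  have h1 : ∑ t ∈ s, g t * ((∑ i ∈ Finset.range (p - 1), C r.1.1 r.1.2 i * u t.1.1 t.1.2 i : ℤ) : ℚ)
      = 0 := by
    simp only [Int.cast_sum, Finset.mul_sum]
    rw [Finset.sum_comm, Finset.sum_range]
    refine Finset.sum_eq_zero fun i _ => ?_
    have h2 := congrArg (fun a : ℚ => (C r.1.1 r.1.2 i : ℚ) * a) (hcoord i)
    simp only [mul_zero, Finset.mul_sum] at h2
    rw [← h2]
    refine Finset.sum_congr rfl fun t _ => ?_
    rw [hb _ _ (hrank t)]
    push_cast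
    ring
  have hlt : ∀ t : {q' : ℕ × ℕ // PairLE q' q}, t.1.1 < p ∧ t.1.2 < p := fun t => by
    have h2 := hrank t
    have h3 := add_lt_pairRank t.1.1 t.1.2
    omega
  have h3 : ∀ t ∈ s, g t * ((∑ i ∈ Finset.range (p - 1),
      C r.1.1 r.1.2 i * u t.1.1 t.1.2 i : ℤ) : ℚ) = if r = t then g t * D else 0 := by
    intro t _
    rw [hu.2 _ (hlt r).1 _ (hlt r).2 _ (hlt t).1 _ (hlt t).2 (hrank r) (hrank t)]
    have : r = t ↔ r.1.1 = t.1.1 ∧ r.1.2 = t.1.2 := Subtype.ext_iff.trans Prod.ext_iff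
    simp only [this]
    split_ifs <;> simp
  rw [Finset.sum_congr rfl h3, Finset.sum_ite_eq s r, if_pos hr] at h1
  exact (mul_eq_zero.1 h1).resolve_right (by exact_mod_cast hu.1)

section Galois

variable (p : ℕ) [Fact p.Prime] {K : Type*} [Field K] [NumberField K]
  [IsCyclotomicExtension {p} ℚ K]

theorem sigma_surjective : Function.Surjective (sigma p K) :=
  (IsCyclotomicExtension.autEquivPow K
    (Polynomial.cyclotomic.irreducible_rat (Nat.Prime.pos (Fact.out : p.Prime)))).symm.surjective

theorem nu_injective : Function.Injective (nu p K) := fun _ _ h =>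
  (sigma p K 1).injective (congrFun h 1)

/-- Reading a relation `∑ g_j ν(v_j) = 0` at the coordinate `σ⁻¹` and applying `σ` gives `∑ σ(g_j)
v_j = 0` for all `σ`. Multiplying by `σ(l)` and summing gives `∑ Tr(g_j l) v_j = 0` with rational
coefficients. So `Tr(g_j l) = 0` for all `l`, and the trace form is nondegenerate. -/
theorem linearIndependent_nu {ι : Type*} {v : ι → K} (h : LinearIndependent ℚ v) :
    LinearIndependent K fun i => nu p K (v i) := by
  have : IsGalois ℚ K := IsCyclotomicExtension.isGalois {p} ℚ K
  rw [linearIndependent_iff'] at h ⊢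
  intro s g hg i hi
  have hσ : ∀ σ : K ≃ₐ[ℚ] K, ∑ j ∈ s, σ (g j) * v j = 0 := by
    intro σ
    obtain ⟨c, hc⟩ := sigma_surjective p σ.symm
    have h1 := congrFun hg c
    simp only [Finset.sum_apply, Pi.smul_apply, smul_eq_mul, Pi.zero_apply] at h1
    have h2 : ∀ j, nu p K (v j) c = σ.symm (v j) := fun j => by rw [← hc]; rfl
    simp only [h2] at h1
    have h3 := congrArg σ h1
    simpa using h3
  have htr : ∀ l : K, Algebra.trace ℚ K (g i * l) = 0 := by
    intro l
    refine h s (fun j => Algebra.trace ℚ K (g j * l)) ?_ i hi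
    have h1 : ∀ j, Algebra.trace ℚ K (g j * l) • v j =
        ∑ σ : K ≃ₐ[ℚ] K, σ l * (σ (g j) * v j) := by
      intro j
      rw [Algebra.smul_def, trace_eq_sum_automorphisms, Finset.sum_mul]
      exact Finset.sum_congr rfl fun σ _ => by rw [map_mul]; ring
    simp only [h1]
    rw [Finset.sum_comm]
    refine Finset.sum_eq_zero fun σ _ => ?_
    rw [← Finset.mul_sum, hσ, mul_zero]
  exact (traceForm_nondegenerate ℚ K).1 (g i) htr

/-- If `a` were outside the `ℚ`-span, adjoining it would keep the family independent, and
`linearIndependent_nu` for the larger family contradicts `ha`. This is what identifies `U_q` with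
the image under `ν` of a `ℚ`-span. -/
theorem mem_span_of_nu_mem_span {ι : Type*} {v : ι → K} (h : LinearIndependent ℚ v) {a : K}
    (ha : nu p K a ∈ Submodule.span K (Set.range fun i => nu p K (v i))) :
    a ∈ Submodule.span ℚ (Set.range v) := by
  by_contra hcon
  have h1 : LinearIndependent ℚ fun o : Option ι => Option.casesOn' o a v :=
    linearIndependent_option'.2 ⟨h, hcon⟩
  have h2 := linearIndependent_nu p h1
  have h3 : (fun o : Option ι => nu p K (Option.casesOn' o a v)) =
      fun o : Option ι => Option.casesOn' o (nu p K a) fun i => nu p K (v i) := by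
    funext o
    cases o <;> rfl
  rw [h3] at h2
  exact (linearIndependent_option'.1 h2).2 ha

variable {ζ : K} {b : ℕ → ℕ → Fin (p - 1) → ℤ} {q : ℕ × ℕ}

theorem spaceU_eq
    (h : LinearIndependent ℚ fun i : {q' : ℕ × ℕ // PairLE q' q} => ofCoords ζ (b i.1.1 i.1.2)) :
    spaceU p ζ b q = (Submodule.span ℚ (Set.range fun i : {q' : ℕ × ℕ // PairLE q' q} =>
      ofCoords ζ (b i.1.1 i.1.2))).map (nu p K) := by
  have himg : coeffVec p ζ b '' {q' | PairLE q' q} =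
      Set.range fun i : {q' : ℕ × ℕ // PairLE q' q} => nu p K (ofCoords ζ (b i.1.1 i.1.2)) := by
    ext v
    simp [coeffVec]
  unfold spaceU
  rw [himg]
  apply le_antisymm
  · rintro v ⟨hv, a, rfl⟩
    exact ⟨a, mem_span_of_nu_mem_span p h hv, rfl⟩
  · rw [Submodule.map_span_le]
    rintro _ ⟨i, rfl⟩
    exact ⟨Submodule.subset_span ⟨i, rfl⟩, _, rfl⟩

theorem finrank_spaceU
    (h : LinearIndependent ℚ fun i : {q' : ℕ × ℕ // PairLE q' q} => ofCoords ζ (b i.1.1 i.1.2)) :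
    Module.finrank ℚ (spaceU p ζ b q) = Omega q := by
  have : Fintype {q' : ℕ × ℕ // PairLE q' q} := (finite_pairLE q).fintype
  rw [spaceU_eq p h, ← (Submodule.equivMapOfInjective _ (nu_injective p) _).finrank_eq,
    finrank_span_eq_card h, Omega, ← Nat.card_coe_set_eq, ← Nat.card_eq_fintype_card]
  rfl

theorem spaceU_mono {q q' : ℕ × ℕ} (hq : PairLE q q') : spaceU p ζ b q ≤ spaceU p ζ b q' := by
  refine inf_le_inf_right _ fun v hv => ?_
  refine Submodule.span_mono (Set.image_mono ?_) hv
  intro r hr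
  exact pairLE_iff.2 ((pairLE_iff.1 hr).trans (pairLE_iff.1 hq))

theorem spaceU_lt_iff {q q' : ℕ × ℕ}
    (h : Module.finrank ℚ (spaceU p ζ b q) = Omega q)
    (h' : Module.finrank ℚ (spaceU p ζ b q') = Omega q') :
    spaceU p ζ b q < spaceU p ζ b q' ↔ PairLT q q' := by
  rw [Omega_eq] at h h'
  constructor
  · intro hlt
    rw [pairLT_iff]
    by_contra hcon
    exact hlt.not_ge (spaceU_mono p (pairLE_iff.2 (not_lt.1 hcon)))
  · intro hlt
    refine lt_of_le_of_ne (spaceU_mono p hlt.1) fun he => ?_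
    rw [pairLT_iff, ← h, ← h', he] at hlt
    exact lt_irrefl _ hlt

end Galois

end SuperFermat

namespace SuperFermat

/-! ### Elementary consequences of the equation -/

namespace IsSolution

variable {p : ℕ} {x y z : ℤ} {e : ℕ}

theorem odd (h : IsSolution p x y z e) : Odd p :=
  h.prime.odd_of_ne_two (by have := h.three_lt; omega)

theorem ne_of_dvd (hpy : ¬ (p : ℤ) ∣ y) {r : ℕ} (hry : (r : ℤ) ∣ y) : r ≠ p := by
  rintro rfl
  exact hpy hry

/-- If `r` divided both `x` and `y`, then cancelling `x + y = r (x' + y')` from `r ^ p (x' ^ p + y'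
^ p)` would leave a factor `r ^ (p - 1)` in `p ^ e z ^ p`, although `r ≠ p` and `r ∤ z`. -/
theorem not_dvd_left (h : IsSolution p x y z e) (hpy : ¬ (p : ℤ) ∣ y) {r : ℕ} (hr : r.Prime)
    (hry : (r : ℤ) ∣ y) : ¬ (r : ℤ) ∣ x := by
  intro hrx
  have hr' : Prime (r : ℤ) := Nat.prime_iff_prime_int.1 hr
  have hz : ¬ (r : ℤ) ∣ z := by
    intro hrz
    have h1 := Int.dvd_coe_gcd hrx (Int.dvd_coe_gcd hry hrz)
    rw [h.coprime] at h1
    exact hr'.not_isUnit (isUnit_of_dvd_one (by exact_mod_cast h1))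
  have hp : ¬ (r : ℤ) ∣ p := by
    rw [Int.natCast_dvd_natCast, Nat.prime_dvd_prime_iff_eq hr h.prime]
    exact ne_of_dvd hpy hry
  obtain ⟨x', rfl⟩ := hrx
  obtain ⟨y', rfl⟩ := hry
  obtain ⟨N, hN⟩ := h.odd.add_dvd_pow_add_pow x' y'
  have h1 := h.eqn
  have h2 := h.add_ne
  have h3 : (r : ℤ) * x' + r * y' = r * (x' + y') := by ring
  rw [mul_pow, mul_pow, ← mul_add, hN, h3] at h1
  rw [h3] at h2
  obtain ⟨q, rfl⟩ : ∃ q, p = q + 2 := ⟨p - 2, by have := h.three_lt; omega⟩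
  have h4 : (r : ℤ) * (x' + y') * (r * (r ^ q * N)) =
      r * (x' + y') * (((q + 2 : ℕ) : ℤ) ^ e * z ^ (q + 2)) := by
    rw [← h1]; ring
  have h5 := mul_left_cancel₀ h2 h4
  have h6 : (r : ℤ) ∣ ((q + 2 : ℕ) : ℤ) ^ e * z ^ (q + 2) := ⟨_, h5.symm⟩
  rcases hr'.dvd_or_dvd h6 with h7 | h7
  · exact hp (hr'.dvd_of_dvd_pow h7)
  · exact hz (hr'.dvd_of_dvd_pow h7)

theorem not_dvd_right (h : IsSolution p x y z e) (hpy : ¬ (p : ℤ) ∣ y) {r : ℕ} (hr : r.Prime)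
    (hry : (r : ℤ) ∣ y) : ¬ (r : ℤ) ∣ z := by
  intro hrz
  have hr' : Prime (r : ℤ) := Nat.prime_iff_prime_int.1 hr
  have hp0 := h.prime.ne_zero
  have h1 : (r : ℤ) ∣ x ^ p + y ^ p := by
    rw [h.eqn]
    exact ((dvd_pow hrz hp0).mul_left _).mul_left _
  have h2 : (r : ℤ) ∣ x ^ p := (dvd_add_left (dvd_pow hry hp0)).1 h1
  exact h.not_dvd_left hpy hr hry (hr'.dvd_of_dvd_pow h2)

theorem isCoprime (h : IsSolution p x y z e) (hpy : ¬ (p : ℤ) ∣ y) :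
    IsCoprime ((p : ℤ) * x) y := by
  rw [Int.isCoprime_iff_gcd_eq_one]
  by_contra hne
  obtain ⟨r, hr, hrd⟩ := Nat.exists_prime_and_dvd hne
  have hrd' : (r : ℤ) ∣ (Int.gcd (p * x) y : ℤ) := Int.natCast_dvd_natCast.2 hrd
  have hry := hrd'.trans (Int.gcd_dvd_right _ _)
  rcases (Nat.prime_iff_prime_int.1 hr).dvd_or_dvd (hrd'.trans (Int.gcd_dvd_left _ _)) with h1 | h1
  · rw [Int.natCast_dvd_natCast, Nat.prime_dvd_prime_iff_eq hr h.prime] at h1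
    exact ne_of_dvd hpy hry h1
  · exact h.not_dvd_left hpy hr hry h1

/-- Only `|x| = 1`, `|y| = 2` has to be excluded. Then `2 ^ p + 1 = 3 p ^ e |z| ^ p` or `2 ^ p - 1 =
p ^ e |z| ^ p`. Reduction modulo `p` excludes `e = 1`, as `p > 3`, and comparison of sizes excludes
`e = 0`. -/
theorem three_le_abs (h : IsSolution p x y z e) (hxy : |x| < |y|) : 3 ≤ |y| := by
  by_contra hlt
  have hx : 1 ≤ |x| := Int.one_le_abs h.x_ne
  have hx1 : |x| = 1 := by omega
  have hy2 : |y| = 2 := by omega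
  have hp := h.prime
  have hp3 := h.three_lt
  have : Fact p.Prime := ⟨hp⟩
  have hpow : (4 : ℤ) < 2 ^ p := by
    calc (4 : ℤ) = 2 ^ 2 := by norm_num
      _ < 2 ^ p := pow_lt_pow_right₀ (by norm_num) (by omega)
  have hcases : (2 : ℤ) ^ p + 1 = 3 * (p ^ e * |z| ^ p) ∨ (2 : ℤ) ^ p - 1 = p ^ e * |z| ^ p := by
    have h1 := congrArg abs h.eqn
    rw [abs_mul, abs_mul, abs_pow z, abs_of_nonneg (a := (p : ℤ) ^ e) (by positivity)] at h1
    have hodd := h.odd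
    rcases abs_eq (by norm_num : (0 : ℤ) ≤ 1) |>.1 hx1 with h2 | h2 <;>
      rcases abs_eq (by norm_num : (0 : ℤ) ≤ 2) |>.1 hy2 with h3 | h3 <;>
      rw [h2, h3] at h1 <;> simp only [hodd.neg_pow, one_pow] at h1
    · left
      rw [abs_of_pos (by positivity), abs_of_pos (by norm_num)] at h1
      linarith
    · right
      rw [abs_of_neg (by linarith), abs_of_neg (by norm_num)] at h1
      linarith
    · right
      rw [abs_of_pos (by linarith), abs_of_pos (by norm_num)] at h1
      linarith
    · left
      rw [abs_of_neg (by linarith), abs_of_neg (by norm_num)] at h1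
      linarith
  have h2p : ((2 : ℤ) : ZMod p) ^ p = 2 := by
    rw [ZMod.pow_card]; norm_num
  have hne : ∀ k : ℕ, 0 < k → k < p → ((k : ℕ) : ZMod p) ≠ 0 := fun k hk hkp h0 => by
    rw [ZMod.natCast_eq_zero_iff] at h0
    exact absurd (Nat.le_of_dvd hk h0) (by omega)
  have he : e = 0 := by
    rcases h.e_mem with he | he
    · exact he
    exfalso
    subst he
    rcases hcases with hc | hc
    · have h1 := congrArg (Int.cast : ℤ → ZMod p) hc
      push_cast at h1 h2p
      rw [h2p, CharP.cast_eq_zero] at h1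
      apply hne 3 (by norm_num) hp3
      push_cast
      simp at h1
      linear_combination h1
    · have h1 := congrArg (Int.cast : ℤ → ZMod p) hc
      push_cast at h1 h2p
      rw [h2p, CharP.cast_eq_zero] at h1
      apply hne 1 (by norm_num) (by omega)
      push_cast
      simp at h1
      linear_combination h1
  rw [he, pow_zero, one_mul] at hcases
  have hz : 1 ≤ |z| := Int.one_le_abs h.z_ne
  rcases hz.eq_or_lt with hz1 | hz2
  · rw [← hz1, one_pow] at hcases
    omega
  · have : (2 : ℤ) ^ p ≤ |z| ^ p := pow_le_pow_left₀ (by norm_num) (by omega) p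
    omega

end IsSolution

end SuperFermat

namespace SuperFermat

/-! ### The local rings -/

section LocalRing

variable (K : Type*) [Field K] [NumberField K] (r : ℕ) [Fact r.Prime]

instance : IsModuleTopology ℚ_[r] (LocalRing K r) := ⟨rfl⟩

instance : Module.Finite ℚ_[r] (LocalRing K r) :=
  inferInstanceAs (Module.Finite ℚ_[r] (ℚ_[r] ⊗[ℚ] K))

instance : IsTopologicalRing (LocalRing K r) := IsModuleTopology.isTopologicalRing ℚ_[r] _

instance : T2Space (LocalRing K r) :=
  let e := (Module.finBasis ℚ_[r] (LocalRing K r)).equivFun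
  T2Space.of_injective_continuous e.injective
    (IsModuleTopology.continuous_of_linearMap (R := ℚ_[r]) e.toLinearMap)

noncomputable instance : Algebra ℤ_[r] (LocalRing K r) :=
  inferInstanceAs (Algebra ℤ_[r] (ℚ_[r] ⊗[ℚ] K))

instance : IsScalarTower ℤ_[r] ℚ_[r] (LocalRing K r) :=
  inferInstanceAs (IsScalarTower ℤ_[r] ℚ_[r] (ℚ_[r] ⊗[ℚ] K))

instance : Nontrivial (LocalRing K r) := inferInstanceAs (Nontrivial (ℚ_[r] ⊗[ℚ] K))

instance : ContinuousSMul ℤ_[r] (LocalRing K r) where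
  continuous_smul := by
    have h : (fun q : ℤ_[r] × LocalRing K r => q.1 • q.2) = fun q => (q.1 : ℚ_[r]) • q.2 := by
      funext q
      exact (algebraMap_smul ℚ_[r] q.1 q.2).symm
    rw [h]
    exact (continuous_subtype_val.comp continuous_fst).smul continuous_snd

variable {K}

theorem toLocalRing_rat_mul (q : ℚ) (k : K) :
    toLocalRing K r (algebraMap ℚ K q * k) = (q : ℚ_[r]) • toLocalRing K r k := by
  rw [← Algebra.smul_def]
  change (1 : ℚ_[r]) ⊗ₜ[ℚ] (q • k) = (q : ℚ_[r]) • ((1 : ℚ_[r]) ⊗ₜ[ℚ] k)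
  rw [← TensorProduct.smul_tmul, TensorProduct.smul_tmul', smul_eq_mul, mul_one, Algebra.smul_def]
  simp

theorem toLocalRing_rat (q : ℚ) :
    toLocalRing K r (algebraMap ℚ K q) = algebraMap ℚ_[r] (LocalRing K r) q := by
  rw [Algebra.algebraMap_eq_smul_one (A := LocalRing K r), ← map_one (toLocalRing K r), ← toLocalRing_rat_mul, mul_one]

/-- The lattice `ℤ_r[ζ]` in `K_r`. -/
noncomputable def localLattice (ζ : K) : Subalgebra ℤ_[r] (LocalRing K r) :=
  Algebra.adjoin ℤ_[r] {toLocalRing K r ζ}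

variable {p : ℕ} [Fact p.Prime] {ζ : K}

theorem isIntegral_toLocalRing (hζ : IsPrimitiveRoot ζ p) :
    IsIntegral ℤ_[r] (toLocalRing K r ζ) := by
  refine IsIntegral.of_pow (Nat.Prime.pos (Fact.out : p.Prime)) ?_
  rw [← map_pow, hζ.pow_eq_one, map_one]
  exact isIntegral_one

/-- The lattice is finitely generated over the compact ring `ℤ_r`, hence compact. Closedness is what
lets integrality pass to the sums of series. -/
theorem isClosed_localLattice (hζ : IsPrimitiveRoot ζ p) :
    IsClosed (localLattice r ζ : Set (LocalRing K r)) :=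
  (Submodule.isCompact_of_fg (isIntegral_toLocalRing r hζ).fg_adjoin_singleton).isClosed

theorem rat_mem_localLattice {q : ℚ} (hq : ‖(q : ℚ_[r])‖ ≤ 1) :
    toLocalRing K r (algebraMap ℚ K q) ∈ localLattice r ζ := by
  rw [toLocalRing_rat]
  have h : algebraMap ℚ_[r] (LocalRing K r) q = algebraMap ℤ_[r] (LocalRing K r) ⟨q, hq⟩ :=
    (IsScalarTower.algebraMap_apply ℤ_[r] ℚ_[r] (LocalRing K r) ⟨q, hq⟩).symm
  rw [h]
  exact (localLattice r ζ).algebraMap_mem _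

theorem norm_le_one_of_mem_localLattice (hζ : IsPrimitiveRoot ζ p) {q : ℚ}
    (h : toLocalRing K r (algebraMap ℚ K q) ∈ localLattice r ζ) : ‖(q : ℚ_[r])‖ ≤ 1 := by
  rw [toLocalRing_rat] at h
  have h1 : IsIntegral ℤ_[r] (algebraMap ℚ_[r] (LocalRing K r) q) :=
    adjoin_le_integralClosure (isIntegral_toLocalRing r hζ) h
  rw [isIntegral_algebraMap_iff (algebraMap ℚ_[r] (LocalRing K r)).injective,
    IsIntegrallyClosed.isIntegral_iff] at h1
  obtain ⟨t, ht⟩ := h1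
  rw [← ht]
  exact t.2

theorem zeta_mem_localLattice : toLocalRing K r ζ ∈ localLattice r ζ :=
  Algebra.subset_adjoin rfl

theorem integer_mem_localLattice (hζ : IsPrimitiveRoot ζ p)
    [IsCyclotomicExtension {p} ℚ K] (a : 𝓞 K) :
    toLocalRing K r a ∈ localLattice r ζ := by
  have h := IsCyclotomicExtension.Rat.isIntegralClosure_adjoin_singleton_of_prime hζ
  obtain ⟨t, ht⟩ := h.isIntegral_iff.1 (NumberField.RingOfIntegers.isIntegral_coe a)
  change toLocalRing K r (algebraMap (𝓞 K) K a) ∈ _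
  rw [← ht]
  refine Algebra.adjoin_induction (p := fun t _ => toLocalRing K r t ∈ localLattice r ζ)
    ?_ ?_ ?_ ?_ t.2
  · rintro _ rfl
    exact zeta_mem_localLattice r
  · intro n
    rw [algebraMap_int_eq, eq_intCast, map_intCast]
    exact intCast_mem _ n
  · intro a b _ _ ha hb
    rw [map_add]
    exact add_mem ha hb
  · intro a b _ _ ha hb
    rw [map_mul]
    exact mul_mem ha hb

/-- For `r ≠ p` the number `k / p` lies in `ℤ_r`, which is closed under the binomial coefficient
functions. -/
theorem norm_choose_le_one {k : ℤ} (hrp : r ≠ p) (n : ℕ) :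
    ‖((Ring.choose ((k : ℚ) / p) n : ℚ) : ℚ_[r])‖ ≤ 1 := by
  have hr : r.Prime := Fact.out
  have hp : p.Prime := Fact.out
  have h1 : ‖(((k : ℚ) / p : ℚ) : ℚ_[r])‖ ≤ 1 := by
    push_cast
    rw [norm_div]
    have h2 : ‖(p : ℚ_[r])‖ = 1 := Padic.norm_natCast_eq_one_iff.2
      ((Nat.coprime_primes hr hp).2 hrp)
    rw [h2, div_one]
    exact Padic.norm_int_le_one k
  have h2 := Ring.map_choose (PadicInt.Coe.ringHom (p := r)) ⟨_, h1⟩ n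
  have h3 := Ring.map_choose (Rat.castHom ℚ_[r]) ((k : ℚ) / p) n
  rw [Rat.coe_castHom] at h3
  rw [h3]
  change ‖Ring.choose (PadicInt.Coe.ringHom (p := r) ⟨_, h1⟩) n‖ ≤ 1
  rw [← h2]
  exact PadicInt.norm_le_one _

variable [IsCyclotomicExtension {p} ℚ K]

/-- Power series with coefficients in the preimage of the lattice form a subring, so it suffices to
treat the binomial factors. Their arguments are roots of unity, hence algebraic integers. -/
theorem coeff_series_mem_localLattice (hζ : IsPrimitiveRoot ζ p) (hrp : r ≠ p)
    (θ : GroupRing p) (n : ℕ) :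
    toLocalRing K r (aCoeff p ζ θ n) ∈ localLattice r ζ := by
  let S : Subring (PowerSeries K) :=
    (PowerSeries.map (algebraMap (((localLattice r ζ).toSubring.comap (toLocalRing K r))) K)).range
  have hS : ∀ f : PowerSeries K,
      (∀ n, toLocalRing K r (PowerSeries.coeff n f) ∈ localLattice r ζ) → f ∈ S := fun f hf =>
    ⟨PowerSeries.mk fun n => ⟨PowerSeries.coeff n f, hf n⟩, by ext n; simp; rfl⟩
  have hS' : ∀ f ∈ S, ∀ n, toLocalRing K r (PowerSeries.coeff n f) ∈ localLattice r ζ := by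
    rintro _ ⟨g, rfl⟩ n
    rw [PowerSeries.coeff_map]
    exact (PowerSeries.coeff n g).2
  have hb : ∀ (k : ℤ) (u : 𝓞 K), binomSeries ((k : ℚ) / p) (u : K) ∈ S := by
    intro k u
    refine hS _ fun n => ?_
    rw [binomSeries, PowerSeries.coeff_mk, map_mul, map_pow]
    exact mul_mem (rat_mem_localLattice r (norm_choose_le_one r hrp n))
      (pow_mem (integer_mem_localLattice r hζ u) n)
  have hint : ∀ (c : (ZMod p)ˣ) (u : K), u ^ p = 1 → ∃ t : 𝓞 K, (t : K) = sigma p K c u := by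
    intro c u hu
    have : IsIntegral ℤ (sigma p K c u) := by
      refine IsIntegral.of_pow (Nat.Prime.pos (Fact.out : p.Prime)) ?_
      rw [← map_pow, hu, map_one]
      exact isIntegral_one
    exact ⟨⟨_, this⟩, rfl⟩
  refine hS' _ (Subring.prod_mem _ fun c _ => mul_mem ?_ ?_) n
  · obtain ⟨t, ht⟩ := hint c ζ hζ.pow_eq_one
    rw [← ht]
    exact hb _ t
  · obtain ⟨t, ht⟩ := hint c ζ⁻¹ (by rw [inv_pow, hζ.pow_eq_one, inv_one])
    rw [← ht, ← neg_div, ← Int.cast_neg]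
    exact hb _ t

end LocalRing

end SuperFermat

/-! ### Integrality of `F_θ(y / x)` and non-vanishing of the leading digit. -/

namespace SuperFermat

theorem iota_apply {K : Type*} [Field K] [NumberField K] (y : ℤ) (k : K)
    (r : y.natAbs.primeFactors) : iota K y k r = toLocalRing K (r : ℕ) k := rfl

theorem mem_of_hasSum {R A ι : Type*} [CommRing R] [CommRing A] [Algebra R A] [TopologicalSpace A]
    {S : Subalgebra R A} (hS : IsClosed (S : Set A)) {f : ι → A} {a : A} (hf : ∀ i, f i ∈ S)
    (h : HasSum f a) : a ∈ S :=
  hS.mem_of_tendsto h (Filter.Eventually.of_forall fun _ => sum_mem fun i _ => hf i)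

theorem natCast_dvd_of_mem_primeFactors {y : ℤ} (r : y.natAbs.primeFactors) : ((r : ℕ) : ℤ) ∣ y :=
  Int.natCast_dvd.2 (Nat.dvd_of_mem_primeFactors r.2)

theorem norm_intCast_eq_one {r : ℕ} [Fact r.Prime] {k : ℤ} (h : ¬ (r : ℤ) ∣ k) :
    ‖(k : ℚ_[r])‖ = 1 :=
  le_antisymm (Padic.norm_int_le_one k) (not_lt.1 fun hlt => h (Padic.norm_intCast_lt_one_iff.1 hlt))

theorem ofCoords_mem_localLattice {p : ℕ} {K : Type*} [Field K] [NumberField K]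
    {ζ : K} (r : ℕ) [Fact r.Prime] (v : Fin (p - 1) → ℤ) :
    toLocalRing K r (ofCoords ζ v) ∈ localLattice r ζ := by
  rw [ofCoords, map_sum]
  refine sum_mem fun i _ => ?_
  rw [map_mul, map_pow, map_intCast]
  exact mul_mem (intCast_mem _ _) (pow_mem (zeta_mem_localLattice r) _)

section

variable {p : ℕ} [Fact p.Prime] {K : Type*} [Field K] [NumberField K]
  {ζ : K} {x y z : ℤ} {e w : ℕ}
  [IsCyclotomicExtension {p} ℚ K] {θ : GroupRing p} {β : 𝓞 K} {b : ℕ → ℕ → Fin (p - 1) → ℤ}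

theorem seriesValue_mem_localLattice (h : IsSolution p x y z e) (hpy : ¬ (p : ℤ) ∣ y)
    (hζ : IsPrimitiveRoot ζ p) (r : y.natAbs.primeFactors) :
    seriesValue p ζ x y θ r ∈ localLattice (r : ℕ) ζ := by
  have hry := natCast_dvd_of_mem_primeFactors r
  have hr : (r : ℕ).Prime := Fact.out
  unfold seriesValue
  by_cases hs : Summable fun n : ℕ => iota K y (aCoeff p ζ θ n * ((y : K) / x) ^ n)
  swap
  -- Without summability the value of the series is `0` by convention, which lies in the lattice as
  -- well.
  · rw [tsum_eq_zero_of_not_summable hs]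
    exact zero_mem _
  refine mem_of_hasSum (isClosed_localLattice r hζ) (fun n => ?_) (Pi.hasSum.1 hs.hasSum r)
  rw [iota_apply, map_mul]
  refine mul_mem (coeff_series_mem_localLattice r hζ (IsSolution.ne_of_dvd hpy hry) θ n) ?_
  have h1 : ((y : K) / x) ^ n = algebraMap ℚ K (((y : ℚ) / x) ^ n) := by simp
  rw [h1]
  refine rat_mem_localLattice r ?_
  push_cast
  rw [norm_pow, norm_div, norm_intCast_eq_one (h.not_dvd_left hpy hr hry), div_one]
  exact pow_le_one₀ (norm_nonneg _) (Padic.norm_int_le_one y)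

theorem aCoeff_zero : aCoeff p ζ θ 0 = 1 := by
  have h : ∀ (q : ℚ) (u : K), PowerSeries.constantCoeff (binomSeries q u) = 1 := fun q u => by
    rw [binomSeries, ← PowerSeries.coeff_zero_eq_constantCoeff_apply, PowerSeries.coeff_mk]
    simp
  rw [aCoeff, PowerSeries.coeff_zero_eq_constantCoeff_apply, series, map_prod]
  exact Finset.prod_eq_one fun c _ => by rw [map_mul, h, h, one_mul]

theorem IsBeta.conj_ne_zero (h : IsSolution p x y z e) (hβ : IsBeta p ζ x y z e θ w β) :
    sigma p K (-1) (β : K) ≠ 0 := by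
  intro h0
  have h1 := hβ.norm_eq
  rw [h0, mul_zero] at h1
  exact pow_ne_zero w (Int.cast_ne_zero.2 h.z_ne) h1.symm

theorem IsBeta.pow_eq (h : IsSolution p x y z e) (hβ : IsBeta p ζ x y z e θ w β) :
    (z : K) ^ w = gamma p β * sigma p K (-1) (β : K) ^ 2 := by
  have h1 := hβ.conj_ne_zero h
  rw [← hβ.norm_eq, gamma]
  field_simp

theorem IsBeta.sq_eq (h : IsSolution p x y z e) (hβ : IsBeta p ζ x y z e θ w β) :
    (β : K) ^ 2 = (z : K) ^ w * gamma p β := by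
  have h1 := hβ.conj_ne_zero h
  rw [← hβ.norm_eq, gamma]
  field_simp

/-- As `c_0 a_0 = 1`, the digits `b_{0,h}` develop `ρ` itself. If the first one vanished, `ρ / r`
would lie in `ℤ_r[ζ]` for a prime `r ∣ y`. By `z ^ w = ρ Φ conj(β) ^ 2`, so would `z ^ w / r`, which
contradicts `r ∤ z`. -/
theorem IsDevelopment.exists_ne_zero (h : IsSolution p x y z e) (hxy : |x| < |y|)
    (hpy : ¬ (p : ℤ) ∣ y) (hζ : IsPrimitiveRoot ζ p) (hβ : IsBeta p ζ x y z e θ w β)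
    (hb : IsDevelopment p ζ x y θ β b) : ∃ i, b 0 0 i ≠ 0 := by
  by_contra! hb0
  obtain ⟨ρ, hρ, hsum⟩ := hb.hasSum
  have hy3 := h.three_le_abs hxy
  have hy1 : y.natAbs ≠ 1 := by
    rw [Int.abs_eq_natAbs] at hy3
    omega
  obtain ⟨r₀, hr₀, hr₀y⟩ := Nat.exists_prime_and_dvd hy1
  obtain ⟨r⟩ : Nonempty y.natAbs.primeFactors :=
    ⟨r₀, Nat.mem_primeFactors.2 ⟨hr₀, hr₀y, by simpa using h.y_ne⟩⟩
  have hry := natCast_dvd_of_mem_primeFactors r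
  have hr : (r : ℕ).Prime := Fact.out
  obtain ⟨y', hy'⟩ := hry
  have hr0 : ((r : ℕ) : ℚ_[(r : ℕ)]) ≠ 0 := by exact_mod_cast hr.ne_zero
  have h0 := Pi.hasSum.1 (hsum 0) r
  have hc : (cDen p 0 : K) * aCoeff p ζ θ 0 = 1 := by
    rw [aCoeff_zero]
    simp [cDen, expE]
  rw [hc, map_one, mul_one] at h0
  have hρr : ((r : ℕ) : ℚ_[(r : ℕ)])⁻¹ • ρ r ∈ localLattice (r : ℕ) ζ := by
    refine mem_of_hasSum (isClosed_localLattice r hζ) (fun k => ?_)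
      (h0.const_smul ((r : ℕ) : ℚ_[(r : ℕ)])⁻¹)
    rw [iota_apply]
    rcases k with _ | k
    · have : ofCoords ζ (b 0 0) = 0 := by simp [ofCoords, hb0]
      rw [this, zero_mul, map_zero, smul_zero]
      exact zero_mem _
    · have h1 : ofCoords ζ (b 0 (k + 1)) * (y : K) ^ (k + 1) =
          algebraMap ℚ K (r : ℕ) * (ofCoords ζ (b 0 (k + 1)) * ((y' * y ^ k : ℤ) : K)) := by
        have : (y : K) = (r : ℕ) * (y' : K) := by
          conv_lhs => rw [hy']
          push_cast
          rfl
        push_cast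
        rw [pow_succ]
        nth_rewrite 2 [this]
        ring
      rw [h1, toLocalRing_rat_mul, smul_smul, Rat.cast_natCast, inv_mul_cancel₀ hr0, one_smul,
        map_mul, map_intCast]
      exact mul_mem (ofCoords_mem_localLattice _ _) (intCast_mem _ _)
  have hconj : IsIntegral ℤ (sigma p K (-1) (β : K)) :=
    map_isIntegral_int _ (NumberField.RingOfIntegers.isIntegral_coe β)
  have hγ := congrFun hρ r
  rw [Pi.mul_apply, iota_apply] at hγ
  have hmem : toLocalRing K r (algebraMap ℚ K ((z : ℚ) ^ w / (r : ℕ))) ∈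
      localLattice (r : ℕ) ζ := by
    have h1 : algebraMap ℚ K ((z : ℚ) ^ w / (r : ℕ)) =
        algebraMap ℚ K ((r : ℕ) : ℚ)⁻¹ * (gamma p β * sigma p K (-1) (β : K) ^ 2) := by
      rw [← hβ.pow_eq h, div_eq_inv_mul, map_mul, map_pow, map_intCast]
    rw [h1, toLocalRing_rat_mul, map_mul, ← hγ, ← smul_mul_assoc, ← smul_mul_assoc, Rat.cast_inv,
      Rat.cast_natCast, map_pow]
    exact mul_mem (mul_mem hρr (seriesValue_mem_localLattice h hpy hζ r))
      (pow_mem (integer_mem_localLattice r hζ ⟨_, hconj⟩) 2)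
  have h2 := norm_le_one_of_mem_localLattice r hζ hmem
  push_cast at h2
  rw [norm_div, norm_pow, norm_intCast_eq_one
    (h.not_dvd_right hpy hr (natCast_dvd_of_mem_primeFactors r)), one_pow, Padic.norm_p,
    one_div, inv_inv] at h2
  have := hr.one_lt
  have h3 : (r : ℕ) ≤ 1 := by exact_mod_cast h2
  omega

end

end SuperFermat

namespace SuperFermat

/-! ### Convergence of the double series -/

theorem hasSum_triangle {A : Type*} [AddCommMonoid A] [TopologicalSpace A] [ContinuousAdd A]
    [RegularSpace A] {f : ℕ × ℕ → A} {a : A} (h : HasSum f a) :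
    HasSum (fun m => ∑ k ∈ Finset.range (m + 1), f (m - k, k)) a := by
  have h1 := (Finset.HasAntidiagonal.sigmaAntidiagonalEquivProd.hasSum_iff.2 h).sigma
    fun m => (Finset.HasAntidiagonal.antidiagonal m).hasSum f
  refine h1.congr_fun fun m => ?_
  rw [← Finset.Nat.sum_antidiagonal_swap, Finset.Nat.sum_antidiagonal_eq_sum_range_succ_mk]
  rfl

theorem cDen_of_lt {p n : ℕ} (hp : p.Prime) (hn : n < p) : cDen p n = p ^ n := by
  rw [cDen, expE, padicValNat.eq_zero_of_not_dvd, add_zero]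
  rw [hp.dvd_factorial]
  omega

section

variable {p : ℕ} {K : Type*} [Field K] [NumberField K]
  {ζ : K} {x y z : ℤ} {e w : ℕ} {b b' : ℕ → ℕ → Fin (p - 1) → ℤ}

/-- With the rational coordinates separated from the powers of `ζ`, convergence and cancellation
become statements about rational numbers. -/
theorem term_eq_sum (n k : ℕ) : term p ζ x y z w b (fun _ _ => 1) n k =
    ∑ i, algebraMap ℚ K ((z : ℚ) ^ w * (b n k i * (y : ℚ) ^ (n + k) /
      ((cDen p n : ℚ) * (x : ℚ) ^ n))) * ζ ^ ((i : ℕ) + 1) := by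
  rw [term, ofCoords, Finset.sum_mul, Finset.sum_div, Finset.mul_sum]
  refine Finset.sum_congr rfl fun i _ => ?_
  simp only [map_mul, map_pow, map_div₀, map_intCast, map_natCast, Nat.cast_one, one_mul]
  ring

theorem sumsTo_of_hasSum {d : ℕ → ℕ → ℕ} {s : K}
    (h : HasSum (fun q : ℕ × ℕ => iota K y (term p ζ x y z w b d q.1 q.2)) (iota K y s)) :
    SumsTo p ζ x y z w b d s := by
  refine ⟨h, ?_⟩
  simp only [map_sum]
  exact hasSum_triangle
    (f := fun q : ℕ × ℕ => iota K y (term p ζ x y z w b d q.1 q.2)) h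

variable [Fact p.Prime]

theorem summable_term (h : IsSolution p x y z e) (hpy : ¬ (p : ℤ) ∣ y)
    (r : y.natAbs.primeFactors) :
    Summable fun q : ℕ × ℕ =>
      toLocalRing K (r : ℕ) (term p ζ x y z w b (fun _ _ => 1) q.1 q.2) := by
  have hry := natCast_dvd_of_mem_primeFactors r
  have hr : (r : ℕ).Prime := Fact.out
  have hp : p.Prime := Fact.out
  simp only [term_eq_sum, map_sum, toLocalRing_rat_mul]
  refine summable_sum fun i _ => Summable.smul_const ?_ _
  have hlt : ‖(y : ℚ_[(r : ℕ)])‖ < 1 := Padic.norm_intCast_lt_one_iff.2 hry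
  have hgeo := summable_geometric_of_lt_one (norm_nonneg (y : ℚ_[(r : ℕ)])) hlt
  refine Summable.of_norm_bounded (hgeo.mul_of_nonneg hgeo (fun n => by positivity)
    fun n => by positivity) fun q => ?_
  have h1 : ‖(cDen p q.1 : ℚ_[(r : ℕ)])‖ = 1 := by
    rw [cDen, Nat.cast_pow, norm_pow, Padic.norm_natCast_eq_one_iff.2
      ((Nat.coprime_primes hr hp).2 (IsSolution.ne_of_dvd hpy hry)), one_pow]
  push_cast
  rw [norm_mul, norm_div, norm_mul, norm_mul, norm_pow, norm_pow, norm_pow, h1,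
    norm_intCast_eq_one (h.not_dvd_left hpy hr hry), one_pow, mul_one, div_one, ← pow_add]
  have h2 : ‖(z : ℚ_[(r : ℕ)])‖ ^ w ≤ 1 := pow_le_one₀ (norm_nonneg _) (Padic.norm_int_le_one z)
  have h3 := Padic.norm_int_le_one (p := (r : ℕ)) (b q.1 q.2 i)
  have h4 : 0 ≤ ‖(y : ℚ_[(r : ℕ)])‖ ^ (q.1 + q.2) := by positivity
  calc _ ≤ 1 * (1 * ‖(y : ℚ_[(r : ℕ)])‖ ^ (q.1 + q.2)) := by gcongr
    _ = _ := by ring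

theorem SumsTo.of_modification (hx : x ≠ 0) {s : K}
    (h : SumsTo p ζ x y z w b (fun _ _ => 1) s) {W : ℕ}
    (hb : ∀ n k, ¬ (n < p ∧ k < W) → b' n k = b n k)
    (hsum : ∀ i, ∑ n ∈ Finset.range p, ∑ k ∈ Finset.range W,
      (b' n k i - b n k i) * (y ^ (n + k) * ((p : ℤ) * x) ^ (p - 1 - n)) = 0) :
    SumsTo p ζ x y z w b' (fun _ _ => 1) s := by
  have hp : p.Prime := Fact.out
  have h0 : ∑ q ∈ Finset.range p ×ˢ Finset.range W, (term p ζ x y z w b' (fun _ _ => 1) q.1 q.2 -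
      term p ζ x y z w b (fun _ _ => 1) q.1 q.2) = 0 := by
    simp only [term_eq_sum, ← Finset.sum_sub_distrib, ← sub_mul, ← map_sub]
    rw [Finset.sum_comm]
    refine Finset.sum_eq_zero fun i _ => ?_
    rw [← Finset.sum_mul, ← map_sum]
    -- The common denominator `(p x) ^ (p - 1)` works because `c_n = p ^ n` for `n < p`.
    have h1 : ∀ q ∈ Finset.range p ×ˢ Finset.range W,
        (z : ℚ) ^ w * (b' q.1 q.2 i * (y : ℚ) ^ (q.1 + q.2) / ((cDen p q.1 : ℚ) * (x : ℚ) ^ q.1)) -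
        (z : ℚ) ^ w * (b q.1 q.2 i * (y : ℚ) ^ (q.1 + q.2) / ((cDen p q.1 : ℚ) * (x : ℚ) ^ q.1)) =
        (z : ℚ) ^ w / ((p : ℚ) * x) ^ (p - 1) * (((b' q.1 q.2 i - b q.1 q.2 i) *
          (y ^ (q.1 + q.2) * ((p : ℤ) * x) ^ (p - 1 - q.1)) : ℤ) : ℚ) := by
      rintro ⟨n, k⟩ hq
      obtain ⟨hn, -⟩ := Finset.mem_product.1 hq
      rw [Finset.mem_range] at hn
      dsimp only at hn ⊢
      rw [cDen_of_lt hp hn]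
      have hx' : (x : ℚ) ≠ 0 := Int.cast_ne_zero.2 hx
      have hp' : (p : ℚ) ≠ 0 := Nat.cast_ne_zero.2 hp.ne_zero
      obtain ⟨m, hm⟩ : ∃ m, p - 1 = n + m := ⟨p - 1 - n, by omega⟩
      rw [hm, Nat.add_sub_cancel_left]
      push_cast
      rw [pow_add ((p : ℚ) * x), mul_pow (p : ℚ) x n]
      field_simp
    rw [Finset.sum_congr rfl h1, ← Finset.mul_sum, ← Int.cast_sum, Finset.sum_product, hsum i]
    simp
  have h2 : HasSum (fun q : ℕ × ℕ => iota K y (term p ζ x y z w b' (fun _ _ => 1) q.1 q.2 -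
      term p ζ x y z w b (fun _ _ => 1) q.1 q.2)) 0 := by
    have h3 : ∑ q ∈ Finset.range p ×ˢ Finset.range W,
        iota K y (term p ζ x y z w b' (fun _ _ => 1) q.1 q.2 -
          term p ζ x y z w b (fun _ _ => 1) q.1 q.2) = 0 := by
      rw [← map_sum, h0, map_zero]
    rw [← h3]
    refine hasSum_sum_of_ne_finset_zero fun q hq => ?_
    rw [Finset.mem_product, Finset.mem_range, Finset.mem_range] at hq
    rw [term, term, hb _ _ hq, sub_self, map_zero]
  have h4 := h.1.add h2
  simp only [← map_add, add_sub_cancel, add_zero] at h4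
  exact sumsTo_of_hasSum h4

theorem IsDevelopment.sumsTo [IsCyclotomicExtension {p} ℚ K] {θ : GroupRing p} {β : 𝓞 K}
    (h : IsSolution p x y z e) (hpy : ¬ (p : ℤ) ∣ y) (hβ : IsBeta p ζ x y z e θ w β)
    (hb : IsDevelopment p ζ x y θ β b) :
    SumsTo p ζ x y z w b (fun _ _ => 1) ((β : K) ^ 2) := by
  obtain ⟨ρ, hρ, hdev⟩ := hb.hasSum
  refine sumsTo_of_hasSum (Pi.hasSum.2 fun r => ?_)
  have hγ : gamma p β ≠ 0 := fun h0 => by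
    have h1 := hβ.pow_eq h
    rw [h0, zero_mul] at h1
    exact pow_ne_zero w (Int.cast_ne_zero.2 h.z_ne) h1
  have hργ := congrFun hρ r
  rw [Pi.mul_apply, iota_apply] at hργ
  -- A series that does not converge would have value `0`, forcing `γ = 0`.
  have hsm : Summable fun n : ℕ => iota K y (aCoeff p ζ θ n * ((y : K) / x) ^ n) := by
    by_contra hns
    rw [seriesValue, tsum_eq_zero_of_not_summable hns, Pi.zero_apply, mul_zero] at hργ
    exact hγ ((toLocalRing K (r : ℕ)).injective (hργ.symm.trans (map_zero _).symm))
  have hΦ := Pi.hasSum.1 hsm.hasSum r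
  have hS := (summable_term (w := w) (ζ := ζ) (b := b) h hpy r).hasSum
  have hfib : ∀ n, HasSum
      (fun k => toLocalRing K (r : ℕ) (term p ζ x y z w b (fun _ _ => 1) n k))
      (toLocalRing K (r : ℕ) ((z : K) ^ w) *
        (ρ r * toLocalRing K (r : ℕ) (aCoeff p ζ θ n * ((y : K) / x) ^ n))) := by
    intro n
    have h1 := (Pi.hasSum.1 (hdev n) r).mul_left (toLocalRing K (r : ℕ)
      ((z : K) ^ w * ((y : K) ^ n / ((cDen p n : K) * (x : K) ^ n))))
    have hc : (cDen p n : K) ≠ 0 := by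
      rw [cDen, Nat.cast_pow]
      exact pow_ne_zero _ (Nat.cast_ne_zero.2 h.prime.ne_zero)
    have hx : (x : K) ≠ 0 := Int.cast_ne_zero.2 h.x_ne
    have h5 : (fun k => toLocalRing K (r : ℕ) (term p ζ x y z w b (fun _ _ => 1) n k)) = fun k =>
        toLocalRing K (r : ℕ) ((z : K) ^ w * ((y : K) ^ n / ((cDen p n : K) * (x : K) ^ n))) *
          iota K y (ofCoords ζ (b n k) * (y : K) ^ k) r := by
      funext k
      rw [iota_apply, ← map_mul]
      congr 1
      rw [term, pow_add, Nat.cast_one, one_mul]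
      ring
    have h6 : toLocalRing K (r : ℕ) ((z : K) ^ w) *
        (ρ r * toLocalRing K (r : ℕ) (aCoeff p ζ θ n * ((y : K) / x) ^ n)) =
        toLocalRing K (r : ℕ) ((z : K) ^ w * ((y : K) ^ n / ((cDen p n : K) * (x : K) ^ n))) *
          (ρ * iota K y ((cDen p n : K) * aCoeff p ζ θ n)) r := by
      rw [Pi.mul_apply, iota_apply, mul_left_comm, mul_left_comm _ (ρ r), ← map_mul, ← map_mul]
      congr 2
      rw [div_pow]
      field_simp
    rw [h5, h6]
    exact h1
  -- The double series converges by the norm bounds, so it may be summed row by row; the rows give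
  -- `z ^ w ρ a_n (y / x) ^ n`.
  have h2 := hS.prod_fiberwise hfib
  have h3 := (hΦ.mul_left (ρ r)).mul_left (toLocalRing K (r : ℕ) ((z : K) ^ w))
  have h4 := h2.unique h3
  change HasSum (fun q : ℕ × ℕ =>
    toLocalRing K (r : ℕ) (term p ζ x y z w b (fun _ _ => 1) q.1 q.2)) _
  rw [h4] at hS
  convert hS using 1
  rw [iota_apply, hβ.sq_eq h, map_mul, ← hργ]
  rfl

end

end SuperFermat

namespace SuperFermat

/-! ### The output of the algorithm -/

theorem isCertificate_congr {p : ℕ} {x y : ℤ} {b b' : ℕ → ℕ → ℕ → ℤ}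
    (h : ∀ n < p, ∀ k < width p x y, ∀ i, b n k i = b' n k i) (s : List ℤ × List ℤ × ℤ)
    (hs : IsCertificate p x y b s) : IsCertificate p x y b' s := by
  rcases hs with hs | ⟨hs, hd⟩
  · left
    rcases hs with hs | hs | hs | ⟨n, hn, k, hk, i, hi, hs⟩ | hs
    · exact Or.inl hs
    · exact Or.inr (Or.inl hs)
    · exact Or.inr (Or.inr (Or.inl hs))
    · exact Or.inr (Or.inr (Or.inr (Or.inl ⟨n, hn, k, hk, i, hi, h n hn k hk i ▸ hs⟩)))
    · refine Or.inr (Or.inr (Or.inr (Or.inr fun i hi => ?_)))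
      rw [← h 0 (by omega) 0 (by unfold width; omega)]
      exact hs i hi
  · refine Or.inr ⟨⟨hs.1, fun i hi => ?_⟩, hd⟩
    rw [← hs.2 i hi]
    refine Finset.sum_congr rfl fun n hn => Finset.sum_congr rfl fun k hk => ?_
    rw [h n (Finset.mem_range.1 hn) k (Finset.mem_range.1 hk)]

/-- Different output positions read blocks of different sizes. They find the same certificate, so
the outputs fit together to one modification, because the search only sees the entries with `n < p`
and `k < width p x y`. -/
theorem searchCode_congr (hc : ∀ p x y b, ∃ s, IsCertificate p x y b s) {p : ℕ} {x y : ℤ}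
    {b b' : ℕ → ℕ → ℕ → ℤ} (h : ∀ n < p, ∀ k < width p x y, ∀ i, b n k i = b' n k i) :
    searchCode hc p x y b = searchCode hc p x y b' := by
  classical
  exact Nat.find_congr' fun {_} => ⟨isCertificate_congr h _,
    isCertificate_congr (fun n hn k hk i => (h n hn k hk i).symm) _⟩

theorem getD_block {N n h : ℕ} (b : ℕ → ℕ → List ℤ) (hn : n < N) (hh : h < N) :
    ((block N b).getD n []).getD h [] = b n h := by
  simp [block, List.getD_eq_getElem?_getD, hn, hh]

/-- The function computed by the algorithm. -/
noncomputable def transform (p : ℕ) (x y : ℤ) (b : ℕ → ℕ → List ℤ) (n h : ℕ) : List ℤ × ℕ :=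
  newCoeff exists_isCertificate (((p, x, y), (n, h)), block (width p x y + n + h + 1) b)

theorem isAlgorithm_transform : IsAlgorithm transform := by
  refine ⟨fun q => width q.1.1 q.1.2.1 q.1.2.2 + q.2.1 + q.2.2 + 1, newCoeff exists_isCertificate,
    ?_, computable_newCoeff _, fun p x y b n h => rfl⟩
  have hw : Primrec fun q : (ℕ × ℤ × ℤ) × (ℕ × ℕ) => width q.1.1 q.1.2.1 q.1.2.2 :=
    primrec_width (Primrec.fst.comp Primrec.fst)
      (Primrec.fst.comp (Primrec.snd.comp Primrec.fst))
      (Primrec.snd.comp (Primrec.snd.comp Primrec.fst))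
  exact (Primrec.nat_add.comp (Primrec.nat_add.comp (Primrec.nat_add.comp hw
    (Primrec.fst.comp Primrec.snd)) (Primrec.snd.comp Primrec.snd)) (Primrec.const 1)).to_comp

/-- A double sequence of integer vectors, extended by zero in the coordinates. -/
def extendZero {d : ℕ} (b : ℕ → ℕ → Fin d → ℤ) (n h i : ℕ) : ℤ :=
  if hi : i < d then b n h ⟨i, hi⟩ else 0

theorem extendZero_coe {d : ℕ} (b : ℕ → ℕ → Fin d → ℤ) (n h : ℕ) (i : Fin d) :
    extendZero b n h i = b n h i := dif_pos i.2

theorem entry_block {d N n h : ℕ} (b : ℕ → ℕ → Fin d → ℤ) (hn : n < N) (hh : h < N) (i : ℕ) :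
    entry (block N fun n h => List.ofFn (b n h)) n h i = extendZero b n h i := by
  rw [entry, getD_block _ hn hh, extendZero, List.getD_eq_getElem?_getD, List.getElem?_ofFn]
  split_ifs <;> rfl

theorem exists_transform_eq {p : ℕ} {x y : ℤ} {b : ℕ → ℕ → Fin (p - 1) → ℤ}
    (hirr : ¬ IsIrregular p x y (extendZero b)) :
    ∃ (b' : ℕ → ℕ → Fin (p - 1) → ℤ) (C : ℕ → ℕ → ℕ → ℤ) (D : ℤ),
      (∀ n h, transform p x y (fun n h => List.ofFn (b n h)) n h = (List.ofFn (b' n h), 1)) ∧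
      IsModification p x y (extendZero b) (extendZero b') ∧ IsDualFamily p (extendZero b') C D ∧
      ∀ n h, ¬ (n < p ∧ h < width p x y) → b' n h = b n h := by
  classical
  have hcert := isCertificate_searchCode exists_isCertificate p x y (extendZero b)
  set s := Denumerable.ofNat (List ℤ × List ℤ × ℤ)
    (searchCode exists_isCertificate p x y (extendZero b)) with hs
  obtain ⟨hmod, hdual⟩ := hcert.resolve_left hirr
  have hpw : p < width p x y := by unfold width; omega
  set b' : ℕ → ℕ → Fin (p - 1) → ℤ := fun n h i =>
    if n < p ∧ h < width p x y then readList s.1 n h i else b n h i with hb'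
  have hext : ∀ n < p, ∀ h < width p x y, ∀ i < p - 1,
      extendZero b' n h i = readList s.1 n h i := by
    intro n hn h hh i hi
    simp only [extendZero, hb']
    rw [dif_pos hi, if_pos ⟨hn, hh⟩]
  refine ⟨b', readList s.2.1, s.2.2, fun n h => ?_,
    ⟨fun n hn h hh i hi => ?_, fun i hi => ?_⟩, ⟨hdual.1, fun n hn h hh n' hn' h' hh' hr hr' => ?_⟩,
    fun n h hnh => ?_⟩
  · have hcode : searchCode exists_isCertificate p x y
        (entry (block (width p x y + n + h + 1) fun n h => List.ofFn (b n h))) =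
        searchCode exists_isCertificate p x y (extendZero b) :=
      searchCode_congr _ fun n' hn' h' hh' i => entry_block b (by omega) (by omega) i
    simp only [transform, newCoeff]
    rw [hcode, ← hs]
    split_ifs with hnh
    · congr 1
      refine List.ext_getElem (by simp) fun i hi hi' => ?_
      simp only [List.getElem_map, List.getElem_range, List.getElem_ofFn, hb']
      rw [if_pos hnh]
    · rw [getD_block _ (by omega) (by omega)]
      congr 2
      funext i
      simp only [hb']
      rw [if_neg hnh]
  · rw [hext n hn h hh i hi]
    exact hmod.1 n hn h hh i hi
  · rw [← hmod.2 i hi]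
    refine Finset.sum_congr rfl fun n hn => Finset.sum_congr rfl fun h hh => ?_
    rw [hext n (Finset.mem_range.1 hn) h (Finset.mem_range.1 hh) i hi]
  · rw [← hdual.2 n hn h hh n' hn' h' hh' hr hr']
    refine Finset.sum_congr rfl fun i hi => ?_
    rw [hext n' hn' h' (by omega) i (Finset.mem_range.1 hi)]
  · funext i
    simp only [hb']
    rw [if_neg hnh]

theorem not_isIrregular {p : ℕ} [Fact p.Prime] {K : Type*} [Field K] [NumberField K]
    [IsCyclotomicExtension {p} ℚ K] {ζ : K} {x y z : ℤ} {e w : ℕ} {θ : GroupRing p} {β : 𝓞 K}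
    {b : ℕ → ℕ → Fin (p - 1) → ℤ} (h : IsSolution p x y z e) (hxy : |x| < |y|)
    (hpy : ¬ (p : ℤ) ∣ y) (hζ : IsPrimitiveRoot ζ p) (hβ : IsBeta p ζ x y z e θ w β)
    (hb : IsDevelopment p ζ x y θ β b) : ¬ IsIrregular p x y (extendZero b) := by
  have hy3 := h.three_le_abs hxy
  rw [Int.abs_eq_natAbs] at hy3
  rintro (hirr | hirr | ⟨g, -, hg1, hgy, hgp⟩ | ⟨n, hn, k, hk, i, hi, hirr⟩ | hirr)
  · have := h.three_lt
    omega
  · omega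
  · have h1 : (g : ℤ) ∣ y := Int.natCast_dvd.2 (Nat.dvd_of_mod_eq_zero hgy)
    have h2 : (g : ℤ) ∣ p * x := Int.natCast_dvd.2 (by
      rw [Int.natAbs_mul, Int.natAbs_natCast]
      exact Nat.dvd_of_mod_eq_zero hgp)
    have h3 := Int.isUnit_iff_natAbs_eq.1 ((h.isCoprime hpy).isUnit_of_dvd' h2 h1)
    rw [Int.natAbs_natCast] at h3
    omega
  · have h1 := hb.digit n k ⟨i, hi⟩
    rw [← extendZero_coe b, Int.abs_eq_natAbs] at h1
    simp only at h1
    omega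
  · obtain ⟨i, hi⟩ := hb.exists_ne_zero h hxy hpy hζ hβ
    rw [← extendZero_coe b] at hi
    exact hi (hirr i i.2)

end SuperFermat

open SuperFermat in
theorem mainTheorem6 :
    ∃ T : ℕ → ℤ → ℤ → (ℕ → ℕ → List ℤ) → ℕ → ℕ → List ℤ × ℕ,
      IsAlgorithm T ∧
      ∀ (p : ℕ) [Fact p.Prime] (x y z : ℤ) (e : ℕ), IsSolution p x y z e →
      |x| < |y| → ¬ (p : ℤ) ∣ y →
      ∀ (K : Type*) [Field K] [NumberField K] [IsCyclotomicExtension {p} ℚ K]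
        (ζ : K), IsPrimitiveRoot ζ p →
      ∀ (θ : GroupRing p) (w : ℕ), IsAdmissible p θ w →
      ∀ β : 𝓞 K, IsBeta p ζ x y z e θ w β →
      ∀ b : ℕ → ℕ → Fin (p - 1) → ℤ, IsDevelopment p ζ x y θ β b →
      ∃ (b' : ℕ → ℕ → Fin (p - 1) → ℤ) (d : ℕ → ℕ → ℕ),
        -- the new coefficients and factors are the output of the algorithm
        (∀ n h, T p x y (fun n h => List.ofFn (b n h)) n h = (List.ofFn (b' n h), d n h)) ∧
        (∀ n h, d n h = 1 ∨ d n h = p) ∧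
        -- only finitely many coefficients are changed
        {q : ℕ × ℕ | b' q.1 q.2 ≠ b q.1 q.2}.Finite ∧
        -- both series have the sum `β ^ 2`
        SumsTo p ζ x y z w b (fun _ _ => 1) ((β : K) ^ 2) ∧
        SumsTo p ζ x y z w b' d ((β : K) ^ 2) ∧
        -- linear independence up to the pair of rank `p - 1`
        (∃ μχ : ℕ × ℕ, Omega μχ = p - 1 ∧
          (∀ q, PairLE q μχ →
            LinearIndependent K (fun i : {q' : ℕ × ℕ // PairLE q' q} => coeffVec p ζ b' i) ∧
            Module.finrank ℚ (spaceU p ζ b' q) = Omega q) ∧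
          (∀ q q', PairLE q μχ → PairLE q' μχ →
            (spaceU p ζ b' q < spaceU p ζ b' q' ↔ PairLT q q'))) ∧
        -- bounds for the coordinates
        (∀ n h i, |b' n h i| < |y|) ∧
        -- the denominators for `n < p`
        (∃ ε : ℕ → ℕ, ∀ n, n < p → (ε n = 0 ∨ ε n = 1) ∧
          ∀ h, d n h * cDen p n = p ^ (n + ε n)) := by
  refine ⟨transform, isAlgorithm_transform, ?_⟩
  intro p hpf x y z e h hxy hpy K _ _ _ ζ hζ θ w _ β hβ b hb
  obtain ⟨b', C, D, hT, hmod, hdual, hfin⟩ :=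
    exists_transform_eq (not_isIrregular h hxy hpy hζ hβ hb)
  have hsum := hb.sumsTo h hpy hβ
  have hp := h.prime
  have hp3 := h.three_lt
  refine ⟨b', fun _ _ => 1, hT, fun _ _ => Or.inl rfl, ?_, hsum, ?_, ?_, fun n k i => ?_,
    fun _ => 0, fun n hn => ⟨Or.inl rfl, fun _ => ?_⟩⟩
  · refine (Finset.finite_toSet (Finset.range p ×ˢ Finset.range (width p x y))).subset fun q hq => ?_
    rw [Finset.mem_coe, Finset.mem_product, Finset.mem_range, Finset.mem_range]
    by_contra hcon
    exact hq (hfin _ _ hcon)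
  · refine hsum.of_modification h.x_ne (W := width p x y) hfin fun i => ?_
    have := hmod.2 i i.2
    simpa only [extendZero_coe] using this
  -- Ranks start at `1`, so the argument `p - 2` produces the pair of rank `p - 1`.
  · obtain ⟨q₀, hq₀⟩ := exists_pairRank_eq (p - 2)
    have hli : ∀ q, PairLE q q₀ → LinearIndependent ℚ
        fun i : {q' : ℕ × ℕ // PairLE q' q} => ofCoords ζ (b' i.1.1 i.1.2) := fun q hq =>
      linearIndependent_ofCoords p hζ hdual (fun n k _ i => (extendZero_coe b' n k i).symm)
        (by have := pairLE_iff.1 hq; omega)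
    refine ⟨q₀, by rw [Omega_eq]; omega, fun q hq => ⟨linearIndependent_nu p (hli q hq),
      finrank_spaceU p (hli q hq)⟩, fun q q' hq hq' => spaceU_lt_iff p
      (finrank_spaceU p (hli q hq)) (finrank_spaceU p (hli q' hq'))⟩
  · by_cases hnk : n < p ∧ k < width p x y
    · have := hmod.1 n hnk.1 k hnk.2 i i.2
      rw [extendZero_coe] at this
      rw [Int.abs_eq_natAbs, Int.abs_eq_natAbs]
      exact_mod_cast this
    · rw [hfin n k hnk]
      have h1 := hb.digit n k i
      have h2 := h.three_le_abs hxy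
      rw [abs_lt]
      omega
  · rw [cDen_of_lt hp hn, one_mul, add_zero]
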